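/- Let $f:\mathbb R\to\mathbb R$ be the continuous piecewise linear function with $f(z)=z+1$ for $z\le-\frac12$, $f(z)=-z$ for $|z|<\frac12$, and $f(z)=z-1$ for $z\ge\frac12$. Let $(\Omega,\mathcal F,\nu)$ be a probability space. Let $0<\eta<1$, $0<\mu_0\le\frac{1-\eta}4$, and $\mu_j=\mu_0\eta^j$ for $j\ge0$, and let $(\Omega_l,\Omega_m,\Omega_r,\Omega_0,\Omega_1,\Omega_2,\dots)$ be a measurable partition of $\Omega$ with $\nu(\Omega_j)=\mu_j$ for $j\ge 0$ and $$\nu(\Omega_l)=\tfrac14-\sum_{j\text{ odd}}\mu_j,\qquad \nu(\Omega_m)=\tfrac12,\qquad \nu(\Omega_r)=\tfrac14-\sum_{j\text{ even}}\mu_j$$ (such partitions exist whenever $\nu$ is nonatomic). Let $0<\alpha_0<\frac14$ and $0<\alpha_{j+1}\le\alpha_j\mu_j$ for all $j\ge0$. Let $v_0=-1,0,1$ on $\Omega_l,\Omega_m,\Omega_r$ respectively and $v_0=(-1)^j\alpha_j$ on $\Omega_j$ for $j\ge0$, and put $\bar v_0=\int_\Omega v_0\,d\nu$. Then the problem $$\partial_tu(x,t)=-f(u(x,t))+\bar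 f(t),\qquad \bar f(t)=\int_\Omega f(u(y,t))\,d\nu(y),\qquad u(x,0)=v_0(x)-\bar v_0,\qquad x\in\Omega,\ t\ge0,$$ has a unique global solution $u$ among functions that are measurable in $x$ and bounded on $\Omega\times[0,T]$ for each $T$; it takes values in $[-\frac32,\frac32]$, and the following hold. (i) Every point $x\in\Omega_m\cup\bigcup_{j\ge0}\Omega_j$ has a phase transition time $\tau(x)\in(0,\infty]$, meaning that $u(x,t)\in(-\frac12,\frac12)$ for $0\le t<\tau(x)$ and $u(x,t)\in[-\frac32,-\frac12]\cup[\frac12,\frac32]$ for $t\ge\tau(x)$. It is constant on each of these sets, $\tau=\tau_m$ on $\Omega_m$ and $\tau=\tau_j$ on $\Omega_j$; moreover $\tau_m=+\infty$, and $\tau_j<\tau_{j+1}$ for all $j\ge0$. (ii) If moreover there is a positive sequence $(\beta_j)$ decreasing to $0$ such that $\alpha_{j+1}\le\alpha_j\mu_j\beta_j^{1/\mu_j}$ for all sufficiently large $j$, then $$\limsup_{t\to\infty}\bar f(t)-\liminf_{t\to\infty}\bar f(t)=\frac{1-\eta}{1+\eta},$$ as $t\to\infty$ the solution $u(\cdot,t)$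 fails to converge in $L^p(\Omega,\nu)$ for every $p\in[0,\infty]$ (convergence in $L^0$ being convergence in measure), and its $\omega$-limit set in $L^2(\Omega,\nu)$ (the set of all $L^2$-limits of sequences $u(\cdot,t_n)$ with $t_n\to\infty$) is exactly the set of the equilibria $\hat u_s$ with $|s|\le\frac12\,\frac{1-\eta}{1+\eta}$, where $\hat u_s$ equals $-1+s$ on $\Omega_l\cup\bigcup_{j\text{ odd}}\Omega_j$, $-s$ on $\Omega_m$, and $1+s$ on $\Omega_r\cup\bigcup_{j\text{ even}}\Omega_j$ (sets of measure $\frac14,\frac12,\frac14$). -/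

import Mathlib

open MeasureTheory Filter Topology Set
open scoped ENNReal

noncomputable section

namespace NonlocalODE

/-- The continuous piecewise linear function with `N`-shaped graph. -/
def fPL (z : ℝ) : ℝ :=
  if z ≤ -(1 / 2) then z + 1 else if z < 1 / 2 then -z else z - 1

/-- The mean of `f(u(·,t))`, where `u t x` stands for `u(x,t)`. -/
def meanForce {Ω : Type*} [MeasurableSpace Ω] (ν : Measure Ω) (f : ℝ → ℝ)
    (u : ℝ → Ω → ℝ) (t : ℝ) : ℝ :=
  ∫ y, f (u t y) ∂ν

/-- `u` is a global solution of `∂ₜ u = -f(u) + ∫ f(u) dν`, `u(·,0) = u₀`, with values in the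
bounded measurable functions: the equation holds at every point `x` and every time `t ≥ 0`
(one-sided derivative at `t = 0`), and `u` is bounded on `[0,T] × Ω` for every `T`.
For locally Lipschitz `f` this is the same as being a `C¹` solution with respect to the sup norm.
Only the values of `u` at times `t ≥ 0` matter. -/
structure IsSolution {Ω : Type*} [MeasurableSpace Ω] (ν : Measure Ω) (f : ℝ → ℝ)
    (u₀ : Ω → ℝ) (u : ℝ → Ω → ℝ) : Prop where
  measurable : ∀ t : ℝ, 0 ≤ t → Measurable (u t)
  bounded : ∀ T : ℝ, ∃ C : ℝ, ∀ t ∈ Icc 0 T, ∀ x, |u t x| ≤ C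
  initial : ∀ x, u 0 x = u₀ x
  equation : ∀ x, ∀ t : ℝ, 0 ≤ t →
    HasDerivWithinAt (fun s => u s x) (-f (u t x) + meanForce ν f u t) (Ici 0) t

/-- The left phase interval. -/
def phaseL : Set ℝ := Icc (-(3 / 2)) (-(1 / 2))

/-- The middle phase interval. -/
def phaseM : Set ℝ := Ioo (-(1 / 2)) (1 / 2)

/-- The right phase interval. -/
def phaseR : Set ℝ := Icc (1 / 2) (3 / 2)

/-- `τ ∈ (0,∞]` is the phase transition time of `u` at the point `x`: the value `u(x,t)` is in the
middle phase for `0 ≤ t < τ`, and in the left or right phase for `t ≥ τ`. -/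
def IsTransitionTime {Ω : Type*} (u : ℝ → Ω → ℝ) (x : Ω) (τ : ℝ≥0∞) : Prop :=
  0 < τ ∧ ∀ t : ℝ, 0 ≤ t →
    (ENNReal.ofReal t < τ → u t x ∈ phaseM) ∧
    (τ ≤ ENNReal.ofReal t → u t x ∈ phaseL ∪ phaseR)

/-- Labels of the cells `Ω_l`, `Ω_m`, `Ω_r` and `Ω_j`, `j = 0, 1, 2, …`, of a partition. -/
inductive Cell : Type
  | l : Cell
  | m : Cell
  | r : Cell
  | idx (j : ℕ) : Cell

/-- The measures of the cells. -/
def cellMass (μ : ℕ → ℝ) : Cell → ℝ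
  | .l => 1 / 4 - ∑' k : ℕ, μ (2 * k + 1)
  | .m => 1 / 2
  | .r => 1 / 4 - ∑' k : ℕ, μ (2 * k)
  | .idx j => μ j

/-- The values on the cells of the initial data before the mean is subtracted. -/
def cellValue (α : ℕ → ℝ) : Cell → ℝ
  | .l => -1
  | .m => 0
  | .r => 1
  | .idx j => (-1) ^ j * α j

/-- The limiting left phase: `Ω_l` and all `Ω_j` with `j` odd. -/
def leftSet {Ω : Type*} (P : Cell → Set Ω) : Set Ω := P .l ∪ ⋃ k : ℕ, P (.idx (2 * k + 1))

/-- The limiting right phase: `Ω_r` and all `Ω_j` with `j` even. -/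
def rightSet {Ω : Type*} (P : Cell → Set Ω) : Set Ω := P .r ∪ ⋃ k : ℕ, P (.idx (2 * k))

/-- The equilibrium with values `-1 + s`, `-s`, `1 + s` (the three roots of `fPL z = s`) on the
left, middle and right sets `L`, `M`, `R`. -/
def equilibrium {Ω : Type*} (L M R : Set Ω) (s : ℝ) (x : Ω) : ℝ :=
  L.indicator (fun _ => -1 + s) x + M.indicator (fun _ => -s) x + R.indicator (fun _ => 1 + s) x

/-- `u(·,t)` converges in `L^p(Ω,ν)` as `t → ∞`, for `p ∈ [0,∞]`; convergence in `L⁰` is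
convergence in measure. -/
def ConvergesInLp {Ω : Type*} [MeasurableSpace Ω] (ν : Measure Ω) (p : ℝ≥0∞)
    (u : ℝ → Ω → ℝ) : Prop :=
  ∃ g : Ω → ℝ, AEStronglyMeasurable g ν ∧
    ((p = 0 ∧ TendstoInMeasure ν u atTop g) ∨
     (p ≠ 0 ∧ MemLp g p ν ∧ Tendsto (fun t => eLpNorm (u t - g) p ν) atTop (𝓝 0)))

/-- The `ω`-limit set of the orbit `t ↦ u(·,t)` in the topology of `L²(Ω,ν)`. -/
def omegaLimitL2 {Ω : Type*} [MeasurableSpace Ω] (ν : Measure Ω) (u : ℝ → Ω → ℝ) :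
    Set (Lp ℝ 2 ν) :=
  {g | ∃ t : ℕ → ℝ, Tendsto t atTop atTop ∧
    Tendsto (fun n => eLpNorm (fun x => u (t n) x - g x) 2 ν) atTop (𝓝 0)}

end NonlocalODE

end

open NonlocalODE

/-! The solution is constant on cells, so the problem is a countable system: `q` on `Ω_m`, `y j` on
`Ω_j`, and two outer values. The mean of `u` stays `0`, hence `F = ∫ (f(u) - u)`, and `f(z) - z` is
`1`, `-2z`, `-1` in the left, middle and right phase. A cell `Ω_j` that has left on the side of sign
`(-1)^j` drops out, so once exactly the cells `j < n` have left, `F = -q + ∑_{j ≥ n} μ_j ((-1)^j - 2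
y_j)`.

In the middle phase differences grow like `e^t`, so `y_j = q + (-1)^j α_j e^t`. With `σ = (-1)^n`
and `A = (1-η)/(2(1+η))` the geometric sums give (`ReducedFlow.force_eq`) `(σ q)' = 2 μ_n/(1-η) (A -
σ q) - 2 e^t ∑_k (-1)^k α_{n+k} μ_{n+k}`, where the last sum lies in `[0, α_n μ_n]`. Thus `σ q` is
pulled towards `A`, and the correction is too weak to push `q` out of `[-A, A]` (`Stage.abs_q_le`);
as `A < 1/2`, the middle cell never leaves. Cell `n` must leave because `α_n e^t` grows, and
`α_{n+1} ≤ α_n μ_n` keeps the later cells strictly inside until then (`Stage.exists_exit`).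
Iterating gives ordered exit times.

Under the fast decay of `α`, the duration of stage `n` times `μ_n` tends to infinity, so `σ q` comes
close to `A` at the end of each stage (`StageTimes.tendsto_peak`) and `q` swings between `A` and
`-A` forever. The mass not yet in the outer phases tends to `0`, so `F + q → 0`, and each outer
value approaches `±1 - q` (`StageTimes.tendsto_outer`). The solution therefore shadows the
equilibria with `s = -q(t)`, and continuity of `q` produces every `s` in between. -/

namespace NonlocalODE

/-! ### Scalar differential inequalities and global existence for bounded Lipschitz fields -/

section Calculus

/-- A bounded Lipschitz autonomous vector field has a solution on `[0, ∞)`. -/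
theorem exists_global_solution {E : Type*} [NormedAddCommGroup E] [NormedSpace ℝ E]
    [CompleteSpace E] {v : E → E} {K L : NNReal} (hv : LipschitzWith K v)
    (hb : ∀ x, ‖v x‖ ≤ L) (x₀ : E) :
    ∃ φ : ℝ → E, φ 0 = x₀ ∧ ∀ t, 0 ≤ t → HasDerivWithinAt φ (v (φ t)) (Ici 0) t := by
  have hloc : ∀ n : ℕ, ∃ φ : ℝ → E, φ 0 = x₀ ∧
      ∀ t ∈ Icc (0 : ℝ) n, HasDerivWithinAt φ (v (φ t)) (Icc 0 n) t := by
    intro n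
    -- Speed at most `L` confines the solution on `[0, n]` to the ball of radius `L * n`.
    have h : IsPicardLindelof (fun _ : ℝ => v)
        (⟨0, ⟨le_refl 0, Nat.cast_nonneg n⟩⟩ : Icc (0 : ℝ) n) x₀ (L * n) 0 L K := by
      refine IsPicardLindelof.of_time_independent (fun x _ => hb x) hv.lipschitzOnWith ?_
      simp
    exact h.exists_eq_forall_mem_Icc_hasDerivWithinAt₀
  choose φ hφ0 hφ using hloc
  have hc : ∀ n : ℕ, ContinuousOn (φ n) (Icc 0 n) := fun n t ht => (hφ n t ht).continuousWithinAt
  have hd : ∀ n m : ℕ, n ≤ m → ∀ t ∈ Ico (0 : ℝ) n,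
      HasDerivWithinAt (φ m) (v (φ m t)) (Ici t) t := by
    intro n m hnm t ht
    have hm : t < (m : ℝ) := ht.2.trans_le (by exact_mod_cast hnm)
    exact ((hφ m t ⟨ht.1, hm.le⟩).mono (Icc_subset_Icc_left ht.1)).mono_of_mem_nhdsWithin
      (Icc_mem_nhdsGE hm)
  have heq : ∀ n m : ℕ, n ≤ m → EqOn (φ n) (φ m) (Icc 0 n) := by
    intro n m hnm
    refine ODE_solution_unique (v := fun _ => v) (fun _ => hv) (hc n) (hd n n le_rfl)
      ((hc m).mono (Icc_subset_Icc_right (by exact_mod_cast hnm))) (hd n m hnm) ?_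
    rw [hφ0, hφ0]
  refine ⟨fun t => φ (⌈t⌉₊ + 1) t, hφ0 _, fun t ht => ?_⟩
  -- By uniqueness the glued function agrees on `[0, N)` with the single solution `φ (N + 1)`, which
  -- can then be differentiated.
  have key : ∀ N : ℕ, ∀ s ∈ Ico (0 : ℝ) N, φ (⌈s⌉₊ + 1) s = φ (N + 1) s := by
    intro N s hs
    have h1 : ⌈s⌉₊ ≤ N := Nat.ceil_le.2 hs.2.le
    refine heq _ _ (by omega) ⟨hs.1, ?_⟩
    push_cast
    linarith [Nat.le_ceil s]
  obtain ⟨N, hN⟩ := exists_nat_gt t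
  have hmem : Ico (0 : ℝ) N ∈ 𝓝[Ici 0] t := by
    rw [← Ici_inter_Iio]
    exact inter_mem self_mem_nhdsWithin (mem_nhdsWithin_of_mem_nhds (Iio_mem_nhds hN))
  have h1 := hφ (N + 1) t ⟨ht, by push_cast; linarith⟩
  have h2 : HasDerivWithinAt (φ (N + 1)) (v (φ (N + 1) t)) (Ici 0) t := by
    refine h1.mono_of_mem_nhdsWithin (mem_of_superset hmem ?_)
    intro s hs
    refine ⟨hs.1, ?_⟩
    push_cast
    linarith [hs.2]
  have h3 := key N t ⟨ht, hN⟩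
  show HasDerivWithinAt (fun t => φ (⌈t⌉₊ + 1) t) (v (φ (⌈t⌉₊ + 1) t)) (Ici 0) t
  rw [h3]
  exact h2.congr_of_eventuallyEq (mem_of_superset hmem (key N)) h3

/-- If `p' ≥ -k p` then `p` decays at most at rate `k`. -/
theorem mul_exp_le_of_deriv_ge {p p' : ℝ → ℝ} {k a b : ℝ} (hab : a ≤ b)
    (hd : ∀ t ∈ Icc a b, HasDerivWithinAt p (p' t) (Icc a b) t)
    (h : ∀ t ∈ Icc a b, -k * p t ≤ p' t) :
    p a * Real.exp (-k * (b - a)) ≤ p b := by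
  have hd2 : ∀ t ∈ Icc a b, HasDerivWithinAt (fun t => p t * Real.exp (k * (t - a)))
      (p' t * Real.exp (k * (t - a)) + p t * (Real.exp (k * (t - a)) * k)) (Icc a b) t := by
    intro t ht
    refine (hd t ht).mul ?_
    have : HasDerivAt (fun t => k * (t - a)) k t := by
      simpa using ((hasDerivAt_id t).sub_const a).const_mul k
    exact this.exp.hasDerivWithinAt
  have hmono : MonotoneOn (fun t => p t * Real.exp (k * (t - a))) (Icc a b) := by
    refine monotoneOn_of_hasDerivWithinAt_nonneg (convex_Icc a b)
      (fun t ht => (hd2 t ht).continuousWithinAt)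
      (fun t ht => (hd2 t (interior_subset ht)).mono interior_subset) ?_
    intro t ht
    have h1 := h t (interior_subset ht)
    have h2 := Real.exp_pos (k * (t - a))
    nlinarith
  have h3 := hmono (left_mem_Icc.2 hab) (right_mem_Icc.2 hab) hab
  simp only [sub_self, mul_zero, Real.exp_zero, mul_one] at h3
  calc p a * Real.exp (-k * (b - a))
      ≤ p b * Real.exp (k * (b - a)) * Real.exp (-k * (b - a)) := by gcongr
    _ = p b := by
      rw [mul_assoc, ← Real.exp_add]
      simp

/-- If `p' ≤ -k p` then `p` decays at least at rate `k`. -/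
theorem le_mul_exp_of_deriv_le {p p' : ℝ → ℝ} {k a b : ℝ} (hab : a ≤ b)
    (hd : ∀ t ∈ Icc a b, HasDerivWithinAt p (p' t) (Icc a b) t)
    (h : ∀ t ∈ Icc a b, p' t ≤ -k * p t) :
    p b ≤ p a * Real.exp (-k * (b - a)) := by
  have := mul_exp_le_of_deriv_ge (p := fun t => -p t) (p' := fun t => -p' t) (k := k) hab
    (fun t ht => (hd t ht).neg) (fun t ht => by have := h t ht; linarith)
  linarith

/-- If `h' ≤ h` wherever `h > 0`, then `h ≤ 0` is preserved. -/
theorem nonpos_of_deriv_le_self {h h' : ℝ → ℝ} {a b : ℝ} (hab : a ≤ b)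
    (hd : ∀ t ∈ Icc a b, HasDerivWithinAt h (h' t) (Icc a b) t) (ha : h a ≤ 0)
    (hle : ∀ t ∈ Icc a b, 0 < h t → h' t ≤ h t) : h b ≤ 0 := by
  -- The barrier `ε e^{2t}` grows at rate `2`, strictly faster than the rate `1` allowed to `h`, so
  -- it cannot be crossed; then `ε → 0`.
  have key : ∀ ε : ℝ, 0 < ε → h b ≤ ε * Real.exp (2 * b) := by
    intro ε hε
    refine image_le_of_deriv_right_lt_deriv_boundary (f := h) (f' := h')
      (B := fun t => ε * Real.exp (2 * t)) (B' := fun t => ε * (Real.exp (2 * t) * 2))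
      (fun t ht => (hd t ht).continuousWithinAt) ?_ ?_ ?_ ?_ (right_mem_Icc.2 hab)
    · intro t ht
      exact ((hd t (Ico_subset_Icc_self ht)).mono
        (Icc_subset_Icc_left ht.1)).mono_of_mem_nhdsWithin (Icc_mem_nhdsGE ht.2)
    · have := Real.exp_pos (2 * a)
      have := mul_pos hε this
      linarith
    · intro t
      have : HasDerivAt (fun t : ℝ => 2 * t) 2 t := by
        simpa using (hasDerivAt_id t).const_mul (2 : ℝ)
      exact this.exp.const_mul ε
    · intro t ht heq
      have h1 := mul_pos hε (Real.exp_pos (2 * t))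
      have h2 := hle t (Ico_subset_Icc_self ht) (by rw [heq]; exact h1)
      rw [heq] at h2
      linarith
  refine le_of_forall_pos_le_add fun ε hε => ?_
  have := key (ε * Real.exp (-(2 * b))) (by positivity)
  rw [mul_assoc, ← Real.exp_add] at this
  simpa using this

end Calculus

/-! ### The nonlinearity and its truncation to the invariant box -/

section Nonlinearity

theorem fPL_of_le {z : ℝ} (h : z ≤ -(1 / 2)) : fPL z = z + 1 := by
  rw [fPL, if_pos h]

theorem fPL_of_ge {z : ℝ} (h : 1 / 2 ≤ z) : fPL z = z - 1 := by
  rw [fPL, if_neg (by linarith), if_neg (by linarith)]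

theorem fPL_of_abs_le {z : ℝ} (h : |z| ≤ 1 / 2) : fPL z = -z := by
  rw [abs_le] at h
  unfold fPL
  split_ifs <;> linarith

theorem fPL_neg (z : ℝ) : fPL (-z) = -fPL z := by
  unfold fPL
  split_ifs <;> linarith

theorem fPL_le_neg {z : ℝ} (h : z ≤ 1 / 2) : fPL z ≤ -z := by
  unfold fPL
  split_ifs <;> linarith

/-- This bound makes the box `[-3/2, 3/2]` invariant: inside it the mean force is at most `1/2` in
modulus, the value of `|f|` at the ends of the box. All speeds are then at most `1`. -/
theorem abs_fPL_le {z : ℝ} (h : |z| ≤ 3 / 2) : |fPL z| ≤ 1 / 2 := by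
  rw [abs_le] at h ⊢
  unfold fPL
  split_ifs <;> constructor <;> linarith

theorem abs_fPL_sub_le (x y : ℝ) : |fPL x - fPL y| ≤ |x - y| := by
  unfold fPL
  split_ifs <;> rw [abs_le] <;> constructor <;>
    cases abs_cases (x - y) <;> linarith

theorem lipschitzWith_fPL : LipschitzWith 1 fPL :=
  LipschitzWith.of_dist_le_mul fun x y => by
    simpa [Real.dist_eq] using abs_fPL_sub_le x y

theorem continuous_fPL : Continuous fPL := lipschitzWith_fPL.continuous

/-- Truncation to `[-3/2, 3/2]`. -/
noncomputable def clampBox (z : ℝ) : ℝ := max (-(3 / 2)) (min z (3 / 2))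

theorem abs_clampBox_le (z : ℝ) : |clampBox z| ≤ 3 / 2 := by
  rw [abs_le, clampBox]
  exact ⟨le_max_left _ _, max_le (by norm_num) (min_le_right _ _)⟩

theorem clampBox_of_abs_le {z : ℝ} (h : |z| ≤ 3 / 2) : clampBox z = z := by
  rw [abs_le] at h
  rw [clampBox, min_eq_left h.2, max_eq_right h.1]

theorem lipschitzWith_clampBox : LipschitzWith 1 clampBox :=
  (LipschitzWith.id.min_const _).const_max _

theorem lipschitzWith_fPL_clampBox : LipschitzWith 1 (fun z => fPL (clampBox z)) := by
  simpa [Function.comp_def] using lipschitzWith_fPL.comp lipschitzWith_clampBox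

end Nonlinearity

/-! ### Existence for the truncated field; invariance of the box removes the truncation -/

section Existence

open BoundedContinuousFunction

variable {ι : Type*} [TopologicalSpace ι]

/-- The truncated nonlinearity applied to a bounded continuous function. -/
noncomputable def truncForce (x : ι →ᵇ ℝ) : ι →ᵇ ℝ := x.comp _ lipschitzWith_fPL_clampBox

theorem truncForce_apply (x : ι →ᵇ ℝ) (c : ι) : truncForce x c = fPL (clampBox (x c)) := rfl

theorem norm_truncForce_le (x : ι →ᵇ ℝ) : ‖truncForce x‖ ≤ 1 / 2 :=
  (norm_le (by norm_num)).2 fun _ => abs_fPL_le (abs_clampBox_le _)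

theorem norm_truncForce_sub_le (x y : ι →ᵇ ℝ) : ‖truncForce x - truncForce y‖ ≤ ‖x - y‖ := by
  refine (norm_le (norm_nonneg _)).2 fun c => ?_
  refine le_trans ?_ ((x - y).norm_coe_le_norm c)
  simpa [Real.dist_eq, truncForce_apply] using
    lipschitzWith_fPL_clampBox.dist_le_mul (x c) (y c)

theorem norm_const_le_abs (r : ℝ) : ‖(const ι r : ι →ᵇ ℝ)‖ ≤ |r| :=
  (norm_le (abs_nonneg r)).2 fun _ => le_rfl

variable [MeasurableSpace ι] [OpensMeasurableSpace ι]

/-- The mean value as a continuous linear functional on bounded continuous functions. -/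
noncomputable def meanCLM (ρ : Measure ι) [IsProbabilityMeasure ρ] : (ι →ᵇ ℝ) →L[ℝ] ℝ :=
  LinearMap.mkContinuous
    { toFun := fun x => ∫ c, x c ∂ρ
      map_add' := fun x y => integral_add (x.integrable ρ) (y.integrable ρ)
      map_smul' := fun a x => integral_const_mul a _ } 1
    fun x => by simpa using x.norm_integral_le_norm ρ

theorem meanCLM_apply (ρ : Measure ι) [IsProbabilityMeasure ρ] (x : ι →ᵇ ℝ) :
    meanCLM ρ x = ∫ c, x c ∂ρ := rfl

theorem abs_meanCLM_le (ρ : Measure ι) [IsProbabilityMeasure ρ] (x : ι →ᵇ ℝ) :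
    |meanCLM ρ x| ≤ ‖x‖ :=
  x.norm_integral_le_norm ρ

/-- The truncated vector field. -/
noncomputable def truncField (ρ : Measure ι) [IsProbabilityMeasure ρ] (x : ι →ᵇ ℝ) : ι →ᵇ ℝ :=
  const ι (meanCLM ρ (truncForce x)) - truncForce x

theorem norm_truncField_le (ρ : Measure ι) [IsProbabilityMeasure ρ] (x : ι →ᵇ ℝ) :
    ‖truncField ρ x‖ ≤ (1 : NNReal) := by
  have h1 := norm_const_le_abs (ι := ι) (meanCLM ρ (truncForce x))
  have h2 := abs_meanCLM_le ρ (truncForce x)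
  have h3 := norm_truncForce_le x
  have h4 := norm_sub_le (const ι (meanCLM ρ (truncForce x))) (truncForce x)
  rw [truncField, NNReal.coe_one]
  linarith

theorem lipschitzWith_truncField (ρ : Measure ι) [IsProbabilityMeasure ρ] :
    LipschitzWith 2 (truncField ρ) := by
  refine LipschitzWith.of_dist_le_mul fun x y => ?_
  rw [dist_eq_norm, dist_eq_norm]
  have h0 : truncField ρ x - truncField ρ y =
      const ι (meanCLM ρ (truncForce x - truncForce y)) - (truncForce x - truncForce y) := by
    rw [map_sub]
    ext c
    simp [truncField]
    ring
  have h1 := norm_const_le_abs (ι := ι) (meanCLM ρ (truncForce x - truncForce y))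
  have h2 := abs_meanCLM_le ρ (truncForce x - truncForce y)
  have h3 := norm_truncForce_sub_le x y
  have h4 := norm_sub_le (const ι (meanCLM ρ (truncForce x - truncForce y)))
    (truncForce x - truncForce y)
  rw [h0]
  push_cast
  linarith

/-- Existence of a solution on a space of bounded continuous functions, with invariance of the box
`[-3/2, 3/2]` and conservation of the mean. -/
theorem exists_boxed_flow (ρ : Measure ι) [IsProbabilityMeasure ρ] (x₀ : ι →ᵇ ℝ)
    (h₀ : ∀ c, |x₀ c| ≤ 3 / 2) :
    ∃ φ : ℝ → ι →ᵇ ℝ, φ 0 = x₀ ∧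
      (∀ t, 0 ≤ t → ∀ c, HasDerivWithinAt (fun s => φ s c)
        (-fPL (φ t c) + ∫ c, fPL (φ t c) ∂ρ) (Ici 0) t) ∧
      (∀ t, 0 ≤ t → ∀ c, |φ t c| ≤ 3 / 2) ∧
      (∀ t, 0 ≤ t → ∫ c, φ t c ∂ρ = ∫ c, x₀ c ∂ρ) := by
  obtain ⟨φ, hφ0, hφ⟩ := exists_global_solution (lipschitzWith_truncField ρ)
    (norm_truncField_le ρ) x₀
  have hd : ∀ t, 0 ≤ t → ∀ c, HasDerivWithinAt (fun s => φ s c)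
      (-fPL (clampBox (φ t c)) + meanCLM ρ (truncForce (φ t))) (Ici 0) t := by
    intro t ht c
    have h := ((evalCLM ℝ c).hasFDerivAt (x := φ t)).comp_hasDerivWithinAt t (hφ t ht)
    refine HasDerivWithinAt.congr_deriv (f := fun s => φ s c) h ?_
    change meanCLM ρ (truncForce (φ t)) - fPL (clampBox (φ t c)) = _
    ring
  have hF : ∀ t, |meanCLM ρ (truncForce (φ t))| ≤ 1 / 2 := fun t =>
    (abs_meanCLM_le _ _).trans (norm_truncForce_le _)
  -- Beyond `±3/2` the truncated force is frozen at `±1/2`, which dominates the mean, so the field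
  -- does not point outwards.
  have hbox : ∀ t, 0 ≤ t → ∀ c, |φ t c| ≤ 3 / 2 := by
    intro t ht c
    have h0 : |φ 0 c| ≤ 3 / 2 := by rw [hφ0]; exact h₀ c
    rw [abs_le] at h0 ⊢
    have hdd : ∀ s ∈ Icc 0 t, HasDerivWithinAt (fun s => φ s c)
        (-fPL (clampBox (φ s c)) + meanCLM ρ (truncForce (φ s))) (Icc 0 t) s := fun s hs =>
      (hd s hs.1 c).mono Icc_subset_Ici_self
    constructor
    · have := nonpos_of_deriv_le_self (h := fun s => -φ s c - 3 / 2) ht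
        (fun s hs => (hdd s hs).neg.sub_const (3 / 2)) (by linarith) (by
          intro s hs hpos
          have h1 : clampBox (φ s c) = -(3 / 2) := by
            rw [clampBox, min_eq_left (by linarith), max_eq_left (by linarith)]
          have h2 := (abs_le.1 (hF s)).1
          rw [h1, fPL_of_le (by norm_num)]
          linarith)
      linarith
    · have := nonpos_of_deriv_le_self (h := fun s => φ s c - 3 / 2) ht
        (fun s hs => (hdd s hs).sub_const (3 / 2)) (by linarith) (by
          intro s hs hpos
          have h1 : clampBox (φ s c) = 3 / 2 := by
            rw [clampBox, min_eq_right (by linarith), max_eq_right (by norm_num)]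
          have h2 := (abs_le.1 (hF s)).2
          rw [h1, fPL_of_ge (by norm_num)]
          linarith)
      linarith
  have hmean : ∀ t, 0 ≤ t → meanCLM ρ (truncForce (φ t)) = ∫ c, fPL (φ t c) ∂ρ := by
    intro t ht
    rw [meanCLM_apply]
    exact integral_congr_ae (Eventually.of_forall fun c => by
      simp only [truncForce_apply, clampBox_of_abs_le (hbox t ht c)])
  refine ⟨φ, hφ0, fun t ht c => ?_, hbox, fun t ht => ?_⟩
  · have := hd t ht c
    rwa [hmean t ht, clampBox_of_abs_le (hbox t ht c)] at this
  -- The field is a mean minus the function averaged, so its own mean vanishes.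
  · have hdm : ∀ s ∈ Icc 0 t, HasDerivWithinAt (fun s => meanCLM ρ (φ s)) 0 (Icc 0 t) s := by
      intro s hs
      have h := ((meanCLM ρ).hasFDerivAt (x := φ s)).comp_hasDerivWithinAt s (hφ s hs.1)
      have h0 : meanCLM ρ (truncField ρ (φ s)) = 0 := by
        have hc : meanCLM ρ (const ι (meanCLM ρ (truncForce (φ s)))) =
            meanCLM ρ (truncForce (φ s)) := by
          rw [meanCLM_apply ρ (const ι _)]
          simp
        rw [truncField, map_sub, hc, sub_self]
      rw [h0] at h
      exact h.mono Icc_subset_Ici_self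
    have h := constant_of_has_deriv_right_zero (f := fun s => meanCLM ρ (φ s)) (a := 0) (b := t)
      (fun s hs => (hdm s hs).continuousWithinAt)
      (fun s hs => ((hdm s (Ico_subset_Icc_self hs)).mono
        (Icc_subset_Icc_left hs.1)).mono_of_mem_nhdsWithin (Icc_mem_nhdsGE hs.2))
      t (right_mem_Icc.2 ht)
    simp only [hφ0] at h
    exact h

end Existence

/-! ### Uniqueness by Picard iteration -/

section Uniqueness

theorem IsSolution.integrable_fPL {Ω : Type*} [MeasurableSpace Ω] {ν : Measure Ω}
    [IsProbabilityMeasure ν] {u₀ : Ω → ℝ} {u : ℝ → Ω → ℝ} (hu : IsSolution ν fPL u₀ u) {t : ℝ}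
    (ht : 0 ≤ t) : Integrable (fun x => fPL (u t x)) ν := by
  obtain ⟨C, hC⟩ := hu.bounded t
  refine Integrable.of_bound
    (continuous_fPL.measurable.comp (hu.measurable t ht)).aestronglyMeasurable C
    (Eventually.of_forall fun x => ?_)
  have h1 := abs_fPL_sub_le (u t x) 0
  rw [fPL_of_abs_le (z := 0) (by norm_num)] at h1
  simp only [neg_zero, sub_zero] at h1
  exact h1.trans (hC t ⟨ht, le_rfl⟩ x)

/-- Solutions are unique for times `t ≥ 0`. -/
theorem IsSolution.eq {Ω : Type*} [MeasurableSpace Ω] {ν : Measure Ω}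
    [IsProbabilityMeasure ν] {u₀ : Ω → ℝ} {u w : ℝ → Ω → ℝ} (hu : IsSolution ν fPL u₀ u)
    (hw : IsSolution ν fPL u₀ w) {T : ℝ} (hT : 0 ≤ T) : w T = u T := by
  obtain ⟨C₁, hC₁⟩ := hu.bounded T
  obtain ⟨C₂, hC₂⟩ := hw.bounded T
  set C := |C₁| + |C₂| with hCdef
  -- Each integration of the previous bound gains a factor `2t/(n+1)`; the `2` counts the local and
  -- the mean term, both 1-Lipschitz. Working at each `x` separately avoids any question of
  -- regularity in time of the sup norm.
  have key : ∀ n : ℕ, ∀ t ∈ Icc 0 T, ∀ x, |w t x - u t x| ≤ C * ((2 * t) ^ n / n.factorial) := by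
    intro n
    induction n with
    | zero =>
      intro t ht x
      have h1 := hC₁ t ht x
      have h2 := hC₂ t ht x
      have h3 := abs_sub (w t x) (u t x)
      simp only [pow_zero, Nat.factorial_zero, Nat.cast_one, div_one, mul_one]
      linarith [le_abs_self C₁, le_abs_self C₂]
    | succ n ih =>
      intro t ht x
      have hd : ∀ s ∈ Icc 0 T, HasDerivWithinAt (fun s => w s x - u s x)
          ((-fPL (w s x) + meanForce ν fPL w s) - (-fPL (u s x) + meanForce ν fPL u s))
          (Icc 0 T) s := fun s hs =>
        ((hw.equation x s hs.1).sub (hu.equation x s hs.1)).mono Icc_subset_Ici_self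
      refine image_norm_le_of_norm_deriv_right_le_deriv_boundary
        (f := fun s => w s x - u s x)
        (B := fun s => C * ((2 * s) ^ (n + 1) / (n + 1).factorial))
        (B' := fun s => 2 * (C * ((2 * s) ^ n / n.factorial)))
        (fun s hs => (hd s hs).continuousWithinAt)
        (fun s hs => ((hd s (Ico_subset_Icc_self hs)).mono
          (Icc_subset_Icc_left hs.1)).mono_of_mem_nhdsWithin (Icc_mem_nhdsGE hs.2)) ?_ ?_ ?_ ht
      · simp [hu.initial, hw.initial]
      · intro s
        have h1 : HasDerivAt (fun s : ℝ => 2 * s) 2 s := by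
          simpa using (hasDerivAt_id s).const_mul (2 : ℝ)
        have h2 := ((h1.pow (n + 1)).div_const ((n + 1).factorial : ℝ)).const_mul C
        refine h2.congr_deriv ?_
        rw [Nat.factorial_succ]
        push_cast
        have : (n.factorial : ℝ) ≠ 0 := by positivity
        have : (n + 1 : ℝ) ≠ 0 := by positivity
        field_simp
      · intro s hs
        have hs' := Ico_subset_Icc_self hs
        have h1 : |fPL (u s x) - fPL (w s x)| ≤ C * ((2 * s) ^ n / n.factorial) := by
          rw [abs_sub_comm]
          exact (abs_fPL_sub_le _ _).trans (ih s hs' x)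
        have h2 : |meanForce ν fPL w s - meanForce ν fPL u s| ≤
            C * ((2 * s) ^ n / n.factorial) := by
          rw [meanForce, meanForce,
            ← integral_sub (hw.integrable_fPL hs'.1) (hu.integrable_fPL hs'.1)]
          have := norm_integral_le_of_norm_le_const (μ := ν)
            (f := fun y => fPL (w s y) - fPL (u s y)) (C := C * ((2 * s) ^ n / n.factorial))
            (Eventually.of_forall fun y => (abs_fPL_sub_le _ _).trans (ih s hs' y))
          simpa using this
        rw [Real.norm_eq_abs]
        have h3 : (-fPL (w s x) + meanForce ν fPL w s) - (-fPL (u s x) + meanForce ν fPL u s) =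
          (fPL (u s x) - fPL (w s x)) + (meanForce ν fPL w s - meanForce ν fPL u s) := by ring
        rw [h3]
        have := abs_add_le (fPL (u s x) - fPL (w s x))
          (meanForce ν fPL w s - meanForce ν fPL u s)
        linarith
  ext x
  have hlim : Tendsto (fun n : ℕ => C * ((2 * T) ^ n / n.factorial)) atTop (𝓝 (C * 0)) :=
    (FloorSemiring.tendsto_pow_div_factorial_atTop (2 * T)).const_mul C
  rw [mul_zero] at hlim
  have := ge_of_tendsto' hlim fun n => key n T (right_mem_Icc.2 hT) x
  exact sub_eq_zero.1 (abs_nonpos_iff.1 this)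

end Uniqueness

/-! ### Parameter estimates and geometric sums -/

section Parameters

/-- The assumptions on the masses `μ j = μ 0 η ^ j` and the amplitudes `α j`. -/
structure Params (η : ℝ) (μ α : ℕ → ℝ) : Prop where
  eta_pos : 0 < η
  eta_lt : η < 1
  mu_zero_pos : 0 < μ 0
  mu_zero_le : μ 0 ≤ (1 - η) / 4
  mu_eq : ∀ j, μ j = μ 0 * η ^ j
  alpha_zero_pos : 0 < α 0
  alpha_zero_lt : α 0 < 1 / 4
  alpha_step : ∀ j, 0 < α (j + 1) ∧ α (j + 1) ≤ α j * μ j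

/-- The limiting amplitude of the oscillation. -/
noncomputable def amplitude (η : ℝ) : ℝ := 1 / 2 * ((1 - η) / (1 + η))

variable {η : ℝ} {μ α : ℕ → ℝ}

namespace Params

theorem amplitude_add_half (h : Params η μ α) : amplitude η + 1 / 2 = 1 / (1 + η) := by
  have := h.eta_pos
  rw [amplitude]
  field_simp
  ring

theorem amplitude_pos (h : Params η μ α) : 0 < amplitude η := by
  have := h.eta_pos
  have := sub_pos.2 h.eta_lt
  rw [amplitude]
  positivity

theorem amplitude_eq (h : Params η μ α) : amplitude η = 1 / 2 - η / (1 + η) := by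
  have := h.eta_pos
  rw [amplitude]
  field_simp
  ring

theorem amplitude_lt (h : Params η μ α) : amplitude η < 1 / 2 := by
  have := h.eta_pos
  rw [h.amplitude_eq]
  have : 0 < η / (1 + η) := by positivity
  linarith

theorem mu_pos (h : Params η μ α) (j : ℕ) : 0 < μ j := by
  have := h.eta_pos
  have := h.mu_zero_pos
  rw [h.mu_eq]
  positivity

theorem mu_succ (h : Params η μ α) (j : ℕ) : μ (j + 1) = η * μ j := by
  rw [h.mu_eq, h.mu_eq j, pow_succ]
  ring

theorem mu_add (h : Params η μ α) (n k : ℕ) : μ (n + k) = μ n * η ^ k := by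
  rw [h.mu_eq, h.mu_eq n, pow_add]
  ring

theorem mu_antitone (h : Params η μ α) : Antitone μ :=
  antitone_nat_of_succ_le fun j => by
    rw [h.mu_succ]
    nlinarith [h.mu_pos j, h.eta_lt]

theorem mu_zero_le_quarter (h : Params η μ α) : μ 0 ≤ 1 / 4 := by
  linarith [h.mu_zero_le, h.eta_pos]

theorem mu_le_quarter (h : Params η μ α) (j : ℕ) : μ j ≤ 1 / 4 :=
  (h.mu_antitone (Nat.zero_le j)).trans h.mu_zero_le_quarter

theorem mu_succ_le (h : Params η μ α) (j : ℕ) : μ (j + 1) ≤ η / 4 := by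
  rw [h.mu_succ]
  nlinarith [h.mu_le_quarter j, h.eta_pos]

theorem alpha_pos (h : Params η μ α) (j : ℕ) : 0 < α j := by
  cases j with
  | zero => exact h.alpha_zero_pos
  | succ j => exact (h.alpha_step j).1

theorem alpha_succ_le (h : Params η μ α) (j : ℕ) : α (j + 1) ≤ α j * μ j := (h.alpha_step j).2

theorem alpha_succ_le_quarter (h : Params η μ α) (j : ℕ) : α (j + 1) ≤ 1 / 4 * α j := by
  nlinarith [h.alpha_succ_le j, h.alpha_pos j, h.mu_le_quarter j]

theorem alpha_antitone (h : Params η μ α) : Antitone α :=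
  antitone_nat_of_succ_le fun j => by linarith [h.alpha_succ_le_quarter j, h.alpha_pos j]

theorem alpha_le_pow (h : Params η μ α) (j : ℕ) : α j ≤ (1 / 4) ^ (j + 1) := by
  induction j with
  | zero => simpa using h.alpha_zero_lt.le
  | succ j ih =>
    rw [pow_succ']
    linarith [h.alpha_succ_le_quarter j]

theorem alpha_le_quarter (h : Params η μ α) (j : ℕ) : α j ≤ 1 / 4 :=
  (h.alpha_antitone (Nat.zero_le j)).trans h.alpha_zero_lt.le

theorem tendsto_alpha (h : Params η μ α) : Tendsto α atTop (𝓝 0) := by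
  refine squeeze_zero (fun j => (h.alpha_pos j).le) h.alpha_le_pow ?_
  exact (tendsto_pow_atTop_nhds_zero_of_lt_one (by norm_num) (by norm_num)).comp
    (tendsto_add_atTop_nat 1)

theorem hasSum_mu (h : Params η μ α) (n : ℕ) :
    HasSum (fun k => μ (n + k)) (μ n / (1 - η)) := by
  simp_rw [h.mu_add, div_eq_mul_inv]
  exact (hasSum_geometric_of_lt_one h.eta_pos.le h.eta_lt).mul_left _

theorem hasSum_mu_alternating (h : Params η μ α) (n : ℕ) :
    HasSum (fun k => (-1) ^ k * μ (n + k)) (μ n / (1 + η)) := by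
  have h1 := (hasSum_geometric_of_abs_lt_one (r := -η)
    (by rw [abs_neg, abs_of_pos h.eta_pos]; exact h.eta_lt)).mul_left (μ n)
  rw [sub_neg_eq_add, ← div_eq_mul_inv] at h1
  refine h1.congr_fun ?_
  intro k
  rw [h.mu_add, neg_pow]
  ring

theorem summable_mu (h : Params η μ α) : Summable μ := by
  simpa using (h.hasSum_mu 0).summable

theorem tendsto_mu (h : Params η μ α) : Tendsto μ atTop (𝓝 0) := h.summable_mu.tendsto_atTop_zero

theorem summable_mul_mu (h : Params η μ α) {g : ℕ → ℝ} {C : ℝ} (hg : ∀ j, |g j| ≤ C) :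
    Summable fun j => μ j * g j := by
  refine Summable.of_norm_bounded (h.summable_mu.mul_right C) fun j => ?_
  rw [Real.norm_eq_abs, abs_mul, abs_of_pos (h.mu_pos j)]
  exact mul_le_mul_of_nonneg_left (hg j) (h.mu_pos j).le

theorem summable_alpha_mul_mu (h : Params η μ α) (n : ℕ) :
    Summable fun k => α (n + k) * μ (n + k) := by
  have h1 : Summable fun j => α j * μ j := by
    refine (h.summable_mul_mu (g := α) (C := 1 / 4) fun j => ?_).congr fun j => mul_comm _ _
    rw [abs_of_pos (h.alpha_pos j)]
    exact h.alpha_le_quarter j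
  simpa [add_comm] using (summable_nat_add_iff n).2 h1

/-- The alternating tail sums of `α j μ j`. -/
noncomputable def _root_.NonlocalODE.tailForce (μ α : ℕ → ℝ) (n : ℕ) : ℝ :=
  ∑' k, (-1) ^ k * (α (n + k) * μ (n + k))

theorem hasSum_tailForce (h : Params η μ α) (n : ℕ) :
    HasSum (fun k => (-1) ^ k * (α (n + k) * μ (n + k))) (tailForce μ α n) :=
  (h.summable_alpha_mul_mu n).alternating.hasSum

theorem antitone_tail (h : Params η μ α) (n : ℕ) :
    Antitone fun k => α (n + k) * μ (n + k) := fun i j hij =>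
  mul_le_mul (h.alpha_antitone (by omega)) (h.mu_antitone (by omega)) (h.mu_pos _).le
    (h.alpha_pos _).le

/-- Leibniz criterion: the terms decrease, so the empty partial sum bounds the series from below and
the first term bounds it from above. -/
theorem tailForce_nonneg (h : Params η μ α) (n : ℕ) : 0 ≤ tailForce μ α n := by
  simpa using (h.antitone_tail n).alternating_series_le_tendsto
    (h.hasSum_tailForce n).tendsto_sum_nat 0

theorem tailForce_le (h : Params η μ α) (n : ℕ) : tailForce μ α n ≤ α n * μ n := by
  simpa using (h.antitone_tail n).tendsto_le_alternating_series
    (h.hasSum_tailForce n).tendsto_sum_nat 0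

end Params

end Parameters

/-! ### The reduced system for the middle and the small cells -/

section ReducedFlow

/-- The system satisfied by the value `q` on the middle cell, the values `y j` on the small cells
and the mean force `F`. -/
structure ReducedFlow (μ α : ℕ → ℝ) (q F : ℝ → ℝ) (y : ℕ → ℝ → ℝ) : Prop where
  deriv_q : ∀ t, 0 ≤ t → HasDerivWithinAt q (-fPL (q t) + F t) (Ici 0) t
  deriv_y : ∀ j t, 0 ≤ t → HasDerivWithinAt (y j) (-fPL (y j t) + F t) (Ici 0) t
  box_q : ∀ t, 0 ≤ t → |q t| ≤ 3 / 2
  box_y : ∀ j t, 0 ≤ t → |y j t| ≤ 3 / 2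
  box_F : ∀ t, 0 ≤ t → |F t| ≤ 1 / 2
  force : ∀ t, 0 ≤ t →
    F t = (fPL (q t) - q t) / 2 + ∑' j, μ j * ((-1) ^ j + (fPL (y j t) - y j t))
  init_q : q 0 = ∑' j, (-1) ^ j * (μ j * (1 - α j))
  init_y : ∀ j, y j 0 = q 0 + (-1) ^ j * α j

theorem neg_one_pow_mul_self (n : ℕ) : ((-1 : ℝ) ^ n) * (-1) ^ n = 1 := by
  rw [← mul_pow]
  simp

theorem abs_neg_one_pow_mul (n : ℕ) (x : ℝ) : |(-1 : ℝ) ^ n * x| = |x| := by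
  simp [abs_mul]

theorem fPL_neg_one_pow_mul (n : ℕ) (x : ℝ) : fPL ((-1) ^ n * x) = (-1) ^ n * fPL x := by
  rcases neg_one_pow_eq_or ℝ n with h | h <;> simp [h, fPL_neg]

/-- Once a point is in the outer phase of sign `(-1) ^ n`, it stays there. -/
theorem outer_phase_invariant {z F : ℝ → ℝ} (n : ℕ)
    (hz : ∀ t, 0 ≤ t → HasDerivWithinAt z (-fPL (z t) + F t) (Ici 0) t)
    (hF : ∀ t, 0 ≤ t → |F t| ≤ 1 / 2) {a b : ℝ} (ha : 0 ≤ a) (hab : a ≤ b)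
    (h : 1 / 2 ≤ (-1) ^ n * z a) : 1 / 2 ≤ (-1) ^ n * z b := by
  -- With `z` now denoting the signed value: below `1/2` one has `f(z) ≤ -z`, so the deficit `1/2 -
  -- z` has derivative at most `1/2 - z`.
  have := nonpos_of_deriv_le_self (h := fun t => 1 / 2 - (-1) ^ n * z t) hab
    (fun t ht => (((hz t (ha.trans ht.1)).mono (fun s hs => ha.trans hs.1 :
      Icc a b ⊆ Ici 0)).const_mul ((-1) ^ n)).const_sub (1 / 2)) (by linarith) (by
    intro t ht hpos
    have h1 := fPL_le_neg (z := (-1) ^ n * z t) (by linarith)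
    have h2 := hF t (ha.trans ht.1)
    rw [← abs_neg_one_pow_mul n, abs_le] at h2
    rw [fPL_neg_one_pow_mul] at h1
    linarith [h2.1])
  linarith

variable {η : ℝ} {μ α : ℕ → ℝ} {q F : ℝ → ℝ} {y : ℕ → ℝ → ℝ}

/-- Differences of middle-phase solutions grow exponentially. -/
theorem sub_eq_mul_exp {z w F : ℝ → ℝ}
    (hz : ∀ t, 0 ≤ t → HasDerivWithinAt z (-fPL (z t) + F t) (Ici 0) t)
    (hw : ∀ t, 0 ≤ t → HasDerivWithinAt w (-fPL (w t) + F t) (Ici 0) t) {b : ℝ} (hb : 0 ≤ b)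
    (hzm : ∀ t ∈ Icc 0 b, |z t| ≤ 1 / 2) (hwm : ∀ t ∈ Icc 0 b, |w t| ≤ 1 / 2) :
    z b - w b = (z 0 - w 0) * Real.exp b := by
  have hd : ∀ t ∈ Icc 0 b, HasDerivWithinAt (fun t => z t - w t) (z t - w t) (Icc 0 b) t := by
    intro t ht
    refine ((((hz t ht.1).sub (hw t ht.1)).mono Icc_subset_Ici_self).congr_deriv ?_)
    rw [fPL_of_abs_le (hzm t ht), fPL_of_abs_le (hwm t ht)]
    ring
  have h1 := mul_exp_le_of_deriv_ge (k := -1) hb hd fun t _ => by simp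
  have h2 := le_mul_exp_of_deriv_le (k := -1) hb hd fun t _ => by simp
  simp only [neg_neg, one_mul, sub_zero] at h1 h2
  exact le_antisymm h2 h1

namespace ReducedFlow

theorem deriv_q_Icc (hf : ReducedFlow μ α q F y) {a b : ℝ} (ha : 0 ≤ a) {t : ℝ}
    (ht : t ∈ Icc a b) : HasDerivWithinAt q (-fPL (q t) + F t) (Icc a b) t :=
  (hf.deriv_q t (ha.trans ht.1)).mono fun _ hs => ha.trans hs.1

theorem continuousOn_q (hf : ReducedFlow μ α q F y) : ContinuousOn q (Ici 0) :=
  fun t ht => (hf.deriv_q t ht).continuousWithinAt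

/-- The values are 1-Lipschitz in time. -/
theorem abs_sub_le_of_flow {z F : ℝ → ℝ}
    (hz : ∀ t, 0 ≤ t → HasDerivWithinAt z (-fPL (z t) + F t) (Ici 0) t)
    (hbox : ∀ t, 0 ≤ t → |z t| ≤ 3 / 2)
    (hF : ∀ t, 0 ≤ t → |F t| ≤ 1 / 2) {a b : ℝ} (ha : 0 ≤ a) (hab : a ≤ b) :
    |z b - z a| ≤ b - a := by
  have h := norm_image_sub_le_of_norm_deriv_le_segment' (f := z) (C := 1) (a := a) (b := b)
    (fun t ht => (hz t (ha.trans ht.1)).mono (fun s hs => ha.trans hs.1 : Icc a b ⊆ Ici 0))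
    (fun t ht => by
      have h0 := ha.trans ht.1
      have h1 := abs_fPL_le (hbox t h0)
      have h2 := hF t h0
      rw [abs_le] at h1 h2
      rw [Real.norm_eq_abs, abs_le]
      constructor <;> linarith) b (right_mem_Icc.2 hab)
  simpa using h

theorem abs_force_term_le (hf : ReducedFlow μ α q F y) {t : ℝ} (ht : 0 ≤ t) (j : ℕ) :
    |(-1) ^ j + (fPL (y j t) - y j t)| ≤ 3 := by
  have h1 := hf.box_y j t ht
  have h2 := abs_fPL_le h1
  have h3 := abs_neg_one_pow_mul j 1
  rw [mul_one, abs_one] at h3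
  have h4 := abs_add_le ((-1 : ℝ) ^ j) (fPL (y j t) - y j t)
  have h5 := abs_sub (fPL (y j t)) (y j t)
  linarith

theorem summable_force (hp : Params η μ α) (hf : ReducedFlow μ α q F y) {t : ℝ} (ht : 0 ≤ t) :
    Summable fun j => μ j * ((-1) ^ j + (fPL (y j t) - y j t)) :=
  hp.summable_mul_mu fun j => hf.abs_force_term_le ht j

/-- Cells in their outer phases do not contribute to the force equation. -/
theorem hasSum_force_of_outer (hp : Params η μ α) (hf : ReducedFlow μ α q F y) {n : ℕ} {t : ℝ}
    (ht : 0 ≤ t) (hq : |q t| ≤ 1 / 2) (hout : ∀ j < n, 1 / 2 ≤ (-1) ^ j * y j t) :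
    HasSum (fun k => μ (n + k) * ((-1) ^ (n + k) + (fPL (y (n + k) t) - y (n + k) t)))
      (F t + q t) := by
  have h1 := (hf.summable_force hp ht).hasSum
  have h2 := hf.force t ht
  rw [fPL_of_abs_le hq] at h2
  have h3 : ∑' j, μ j * ((-1) ^ j + (fPL (y j t) - y j t)) = F t + q t := by linarith
  rw [h3, ← hasSum_nat_add_iff' n] at h1
  have h4 : ∑ j ∈ Finset.range n, μ j * ((-1) ^ j + (fPL (y j t) - y j t)) = 0 := by
    refine Finset.sum_eq_zero fun j hj => ?_
    have h5 := fPL_of_ge (hout j (Finset.mem_range.1 hj))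
    rw [fPL_neg_one_pow_mul] at h5
    have h6 : (-1) ^ j * ((-1) ^ j + (fPL (y j t) - y j t)) = 0 := by
      rw [mul_add, neg_one_pow_mul_self, mul_sub, h5]
      ring
    have h7 : (-1 : ℝ) ^ j ≠ 0 := by simp
    rw [(mul_eq_zero.1 h6).resolve_left h7, mul_zero]
  rw [h4, sub_zero] at h1
  simpa only [add_comm _ n] using h1

/-- The mean force is `-q` up to the mass of the cells that are not in their outer phases. -/
theorem abs_force_add_le (hp : Params η μ α) (hf : ReducedFlow μ α q F y) {n : ℕ} {t : ℝ}
    (ht : 0 ≤ t) (hq : |q t| ≤ 1 / 2) (hout : ∀ j < n, 1 / 2 ≤ (-1) ^ j * y j t) :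
    |F t + q t| ≤ μ n / (1 - η) * 3 := by
  have h1 := hf.hasSum_force_of_outer hp ht hq hout
  rw [← h1.tsum_eq, ← Real.norm_eq_abs]
  refine tsum_of_norm_bounded ((hp.hasSum_mu n).mul_right 3) fun k => ?_
  rw [Real.norm_eq_abs, abs_mul, abs_of_pos (hp.mu_pos _)]
  exact mul_le_mul_of_nonneg_left (hf.abs_force_term_le ht _) (hp.mu_pos _).le

/-- The force equation when the cells `j < n` are in their outer phases and all other small cells
are in the middle phase. -/
theorem hasSum_force (hp : Params η μ α) (hf : ReducedFlow μ α q F y) {n : ℕ} {t : ℝ}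
    (ht : 0 ≤ t) (hq : |q t| ≤ 1 / 2) (hy : ∀ j, n ≤ j → |y j t| ≤ 1 / 2)
    (hout : ∀ j < n, 1 / 2 ≤ (-1) ^ j * y j t) :
    HasSum (fun k => μ (n + k) * ((-1) ^ (n + k) - 2 * y (n + k) t)) (F t + q t) := by
  refine (hf.hasSum_force_of_outer hp ht hq hout).congr_fun fun k => ?_
  rw [fPL_of_abs_le (hy (n + k) (by omega))]
  ring

/-- The equation for `q` while exactly the cells `j < n` have left the middle phase. -/
theorem force_eq (hp : Params η μ α) (hf : ReducedFlow μ α q F y) {n : ℕ} {t : ℝ}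
    (ht : 0 ≤ t) (hq : |q t| ≤ 1 / 2) (hy : ∀ j, n ≤ j → |y j t| ≤ 1 / 2)
    (hout : ∀ j < n, 1 / 2 ≤ (-1) ^ j * y j t)
    (hexp : ∀ j, n ≤ j → y j t = q t + (-1) ^ j * α j * Real.exp t) :
    (-1) ^ n * (F t + q t) = μ n / (1 + η) - 2 * (μ n / (1 - η)) * ((-1) ^ n * q t)
      - 2 * Real.exp t * tailForce μ α n := by
  have h1 := (hf.hasSum_force hp ht hq hy hout).mul_left ((-1) ^ n)
  have h2 := ((hp.hasSum_mu_alternating n).sub ((hp.hasSum_mu n).mul_left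
    (2 * ((-1) ^ n * q t)))).sub ((hp.hasSum_tailForce n).mul_left (2 * Real.exp t))
  have h3 := h1.unique (h2.congr_fun fun k => ?_)
  · rw [h3]
    ring
  · rw [hexp (n + k) (by omega), pow_add]
    linear_combination (μ (n + k) * (-1) ^ k - 2 * μ (n + k) * (-1) ^ k * α (n + k) * Real.exp t)
      * neg_one_pow_mul_self n

end ReducedFlow

end ReducedFlow

/-! ### Stages between successive exits -/

section Stages

variable {η : ℝ} {μ α : ℕ → ℝ} {q F : ℝ → ℝ} {y : ℕ → ℝ → ℝ} {n : ℕ} {a b t : ℝ}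

/-- At time `a` exactly the cells `j < n` have left the middle phase. -/
structure Stage (η : ℝ) (q : ℝ → ℝ) (y : ℕ → ℝ → ℝ) (n : ℕ) (a : ℝ) : Prop where
  nonneg : 0 ≤ a
  q_le : ∀ t ∈ Icc 0 a, |q t| ≤ amplitude η
  y_lt : ∀ j, n ≤ j → ∀ t ∈ Icc 0 a, |y j t| < 1 / 2
  outer : ∀ j < n, 1 / 2 ≤ (-1) ^ j * y j a

/-- The middle cell and the cells `j ≥ n` are in the closed middle phase during `[a, b]`. -/
def MiddleOn (q : ℝ → ℝ) (y : ℕ → ℝ → ℝ) (n : ℕ) (a b : ℝ) : Prop :=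
  ∀ t ∈ Icc a b, |q t| ≤ 1 / 2 ∧ ∀ j, n ≤ j → |y j t| ≤ 1 / 2

theorem MiddleOn.mono (hM : MiddleOn q y n a b) (ht : t ≤ b) : MiddleOn q y n a t :=
  fun s hs => hM s ⟨hs.1, hs.2.trans ht⟩

namespace Stage

theorem outer_of_le (hf : ReducedFlow μ α q F y) (hs : Stage η q y n a) (hat : a ≤ t) :
    ∀ j < n, 1 / 2 ≤ (-1) ^ j * y j t := fun j hj =>
  outer_phase_invariant j (hf.deriv_y j) hf.box_F hs.nonneg hat (hs.outer j hj)

/-- Cell `j` and the middle cell have both been in the middle phase since time `0`, so their initial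
difference has been amplified by exactly `e^t`. -/
theorem eq_exp (hp : Params η μ α) (hf : ReducedFlow μ α q F y) (hs : Stage η q y n a)
    (hM : MiddleOn q y n a b) (ht : t ∈ Icc a b) (j : ℕ) (hj : n ≤ j) :
    y j t = q t + (-1) ^ j * α j * Real.exp t := by
  have h := sub_eq_mul_exp (b := t) (hf.deriv_y j) hf.deriv_q (hs.nonneg.trans ht.1) ?_ ?_
  · rw [hf.init_y j] at h
    linear_combination h
  all_goals
    intro s hs'
    rcases le_total s a with h1 | h1
  · exact (hs.y_lt j hj s ⟨hs'.1, h1⟩).le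
  · exact (hM s ⟨h1, hs'.2.trans ht.2⟩).2 j hj
  · exact (hs.q_le s ⟨hs'.1, h1⟩).trans hp.amplitude_lt.le
  · exact (hM s ⟨h1, hs'.2.trans ht.2⟩).1

theorem alpha_mul_exp (hp : Params η μ α) (hf : ReducedFlow μ α q F y) (hs : Stage η q y n a)
    (hM : MiddleOn q y n a b) (ht : t ∈ Icc a b) :
    α n * Real.exp t = (-1) ^ n * y n t - (-1) ^ n * q t := by
  rw [hs.eq_exp hp hf hM ht n le_rfl]
  linear_combination -(α n * Real.exp t) * neg_one_pow_mul_self n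

theorem alpha_mul_exp_le (hp : Params η μ α) (hf : ReducedFlow μ α q F y)
    (hs : Stage η q y n a) (hM : MiddleOn q y n a b) (ht : t ∈ Icc a b) :
    α n * Real.exp t ≤ 1 / 2 - (-1) ^ n * q t := by
  rw [hs.alpha_mul_exp hp hf hM ht]
  have := (hM t ht).2 n le_rfl
  rw [← abs_neg_one_pow_mul n, abs_le] at this
  linarith [this.2]

theorem alpha_mul_exp_le_one (hp : Params η μ α) (hf : ReducedFlow μ α q F y)
    (hs : Stage η q y n a) (hM : MiddleOn q y n a b) (ht : t ∈ Icc a b) :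
    α n * Real.exp t ≤ 1 := by
  have h1 := hs.alpha_mul_exp_le hp hf hM ht
  have h2 := (hM t ht).1
  rw [← abs_neg_one_pow_mul n, abs_le] at h2
  linarith [h2.1]

theorem deriv_eq (hp : Params η μ α) (hf : ReducedFlow μ α q F y) (hs : Stage η q y n a)
    (hM : MiddleOn q y n a b) (ht : t ∈ Icc a b) :
    (-1) ^ n * (-fPL (q t) + F t) =
      μ n / (1 + η) - 2 * (μ n / (1 - η)) * ((-1) ^ n * q t)
        - 2 * Real.exp t * tailForce μ α n := by
  rw [← hf.force_eq hp (hs.nonneg.trans ht.1) (hM t ht).1 (hM t ht).2 (hs.outer_of_le hf ht.1)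
    (hs.eq_exp hp hf hM ht), fPL_of_abs_le (hM t ht).1]
  ring

/-- The resting point of `(-1)^n q` in stage `n`, without the exponential term, is the same for
every `n`: geometric masses make the alternating and the plain tail sums proportional. -/
theorem _root_.NonlocalODE.Params.drift_eq (hp : Params η μ α) (n : ℕ) :
    μ n / (1 + η) = 2 * (μ n / (1 - η)) * amplitude η := by
  have := hp.eta_pos
  have := (sub_pos.2 hp.eta_lt).ne'
  rw [amplitude]
  field_simp

/-- During a stage `(-1) ^ n q` is attracted to the amplitude up to the growth of the next
exiting cell. -/
theorem deriv_gap_le (hp : Params η μ α) (hf : ReducedFlow μ α q F y) (hs : Stage η q y n a)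
    (hM : MiddleOn q y n a b) (ht : t ∈ Icc a b) :
    -(2 * (μ n / (1 - η))) * (amplitude η - (-1) ^ n * q t) ≤ -((-1) ^ n * (-fPL (q t) + F t)) ∧
    -((-1) ^ n * (-fPL (q t) + F t)) ≤
      -(2 * (μ n / (1 - η))) * (amplitude η - (-1) ^ n * q t)
        + 2 * μ n * (α n * Real.exp t) := by
  rw [hs.deriv_eq hp hf hM ht, hp.drift_eq]
  have h1 := mul_nonneg (Real.exp_pos t).le (hp.tailForce_nonneg n)
  have h2 := mul_le_mul_of_nonneg_left (hp.tailForce_le n) (Real.exp_pos t).le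
  constructor <;> linarith

/-- Write `σ = (-1)^n` and `A` for the amplitude. The upper barrier is immediate, since the
correction only lowers `σ q`. For the lower one, `α_n e^t ≤ 1/2 - σ q` because cell `n` is still
inside; with `A + 1/2 = 1/(1+η)` the constant terms cancel exactly and `A + σ q` decays at most
exponentially. -/
theorem abs_q_le (hp : Params η μ α) (hf : ReducedFlow μ α q F y) (hs : Stage η q y n a)
    (hM : MiddleOn q y n a b) (ht : t ∈ Icc a b) : |q t| ≤ amplitude η := by
  have hM' := hM.mono ht.2
  have ha := hs.q_le a ⟨hs.nonneg, le_rfl⟩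
  rw [← abs_neg_one_pow_mul n, abs_le] at ha ⊢
  have hd : ∀ s ∈ Icc a t, HasDerivWithinAt (fun s => (-1) ^ n * q s)
      ((-1) ^ n * (-fPL (q s) + F s)) (Icc a t) s := fun s hs' =>
    (hf.deriv_q_Icc hs.nonneg hs').const_mul _
  constructor
  -- The rate is the relaxation rate `2 μ_n/(1-η)` minus the `2 μ_n` coming from the bound on `α_n
  -- e^t`.
  · have h1 := mul_exp_le_of_deriv_ge (k := 2 * (μ n / (1 - η)) - 2 * μ n) ht.1
      (fun s hs' => (hd s hs').const_add (amplitude η)) (fun s hs' => by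
        have h2 := (hs.deriv_gap_le hp hf hM' hs').2
        have h3 := hs.alpha_mul_exp_le hp hf hM' hs'
        have h4 := hp.drift_eq n
        have h5 : μ n / (1 + η) = μ n * (amplitude η + 1 / 2) := by
          rw [hp.amplitude_add_half]
          ring
        have h6 := mul_le_mul_of_nonneg_left h3 (mul_pos two_pos (hp.mu_pos n)).le
        linarith)
    have h2 := mul_nonneg (by linarith : 0 ≤ amplitude η + (-1) ^ n * q a)
      (Real.exp_pos (-(2 * (μ n / (1 - η)) - 2 * μ n) * (t - a))).le
    linarith
  · have h1 := mul_exp_le_of_deriv_ge (k := 2 * (μ n / (1 - η))) ht.1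
      (fun s hs' => (hd s hs').const_sub (amplitude η))
      (fun s hs' => (hs.deriv_gap_le hp hf hM' hs').1)
    have h2 := mul_nonneg (by linarith : 0 ≤ amplitude η - (-1) ^ n * q a)
      (Real.exp_pos (-(2 * (μ n / (1 - η))) * (t - a))).le
    linarith

end Stage

theorem ReducedFlow.q_zero_eq (hp : Params η μ α) (hf : ReducedFlow μ α q F y) :
    q 0 = μ 0 / (1 + η) - tailForce μ α 0 := by
  rw [hf.init_q]
  refine HasSum.tsum_eq ?_
  refine ((hp.hasSum_mu_alternating 0).sub (hp.hasSum_tailForce 0)).congr_fun fun k => ?_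
  simp only [zero_add]
  ring

theorem ReducedFlow.q_zero_bounds (hp : Params η μ α) (hf : ReducedFlow μ α q F y) :
    μ 0 / 2 - α 0 * μ 0 ≤ q 0 ∧ q 0 ≤ amplitude η / 2 := by
  have h1 := hp.tailForce_nonneg 0
  have h2 := hp.tailForce_le 0
  have h0 := hp.eta_pos
  have h3 : μ 0 / (1 + η) ≤ amplitude η / 2 := by
    rw [amplitude, div_le_iff₀ (by linarith)]
    field_simp
    linarith [hp.mu_zero_le]
  have h4 : μ 0 / 2 ≤ μ 0 / (1 + η) :=
    div_le_div_of_nonneg_left hp.mu_zero_pos.le (by linarith) (by linarith [hp.eta_lt])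
  rw [hf.q_zero_eq hp]
  constructor <;> linarith

theorem stage_zero (hp : Params η μ α) (hf : ReducedFlow μ α q F y) : Stage η q y 0 0 := by
  obtain ⟨h1, h2⟩ := hf.q_zero_bounds hp
  have h3 : 0 ≤ q 0 := by nlinarith [hp.alpha_zero_lt, hp.mu_zero_pos]
  have h4 := hp.amplitude_lt
  refine ⟨le_rfl, ?_, ?_, by simp⟩
  · intro t ht
    rw [Icc_self, mem_singleton_iff] at ht
    rw [ht, abs_of_nonneg h3]
    linarith
  · intro j _ t ht
    rw [Icc_self, mem_singleton_iff] at ht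
    rw [ht, hf.init_y]
    have h5 := abs_add_le (q 0) ((-1) ^ j * α j)
    rw [abs_neg_one_pow_mul, abs_of_pos (hp.alpha_pos j), abs_of_nonneg h3] at h5
    linarith [hp.alpha_le_quarter j]

namespace Stage

/-- For `n ≥ 1` one has `μ_n ≤ η/4`, hence `α_j e^t ≤ α_n μ_n e^t ≤ η/4`, while the amplitude is
`1/2 - η/(1+η) ≤ 1/2 - η/2`. -/
theorem abs_later_le_of_pos (hp : Params η μ α) (hf : ReducedFlow μ α q F y)
    (hs : Stage η q y n a) (hn : n ≠ 0) (hM : MiddleOn q y n a b) (ht : t ∈ Icc a b) {j : ℕ}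
    (hj : n < j) : |y j t| ≤ 1 / 2 - η / 16 := by
  obtain ⟨m, rfl⟩ := Nat.exists_eq_succ_of_ne_zero hn
  have h1 := hs.abs_q_le hp hf hM ht
  have h2 := hs.alpha_mul_exp_le_one hp hf hM ht
  have h3 := abs_add_le (q t) ((-1) ^ j * (α j * Real.exp t))
  have he := Real.exp_pos t
  rw [abs_neg_one_pow_mul, abs_of_pos (mul_pos (hp.alpha_pos j) he), ← mul_assoc,
    ← hs.eq_exp hp hf hM ht j hj.le] at h3
  have h4 : α j * Real.exp t ≤ η / 4 := by
    have h5 := (hp.alpha_antitone (Nat.succ_le_of_lt hj)).trans (hp.alpha_succ_le _)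
    have h6 := mul_le_mul_of_nonneg_right h5 he.le
    have h7 := mul_le_mul h2 (hp.mu_succ_le m) (hp.mu_pos _).le zero_le_one
    linarith
  have h8 : η / 2 ≤ η / (1 + η) :=
    div_le_div_of_nonneg_left hp.eta_pos.le (by linarith [hp.eta_pos]) (by linarith [hp.eta_lt])
  have h9 := hp.amplitude_eq
  linarith [hp.eta_pos]

/-- In stage `0` the mass `μ_0` need not be small compared with `η`, so the crude bound on `q` is
replaced by a lower bound drawn from the initial value of `q`. -/
theorem abs_later_le_of_zero (hp : Params η μ α) (hf : ReducedFlow μ α q F y)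
    (hM : MiddleOn q y 0 0 b) (ht : t ∈ Icc 0 b) {j : ℕ} (hj : 0 < j) :
    |y j t| ≤ 1 / 2 - η / 16 := by
  have hs := stage_zero hp hf
  have hM' := hM.mono ht.2
  have hq := (abs_le.1 (hs.abs_q_le hp hf hM ht)).2
  have he := Real.exp_pos t
  have hX1 := hs.alpha_mul_exp_le_one hp hf hM ht
  have hX := hs.alpha_mul_exp_le hp hf hM ht
  rw [pow_zero, one_mul] at hX
  have hμ := hp.mu_zero_pos
  have hμ4 := hp.mu_zero_le_quarter
  have hη := hp.eta_pos
  have hη1 := hp.eta_lt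
  -- Since `q ≤ amplitude η`, the function `q + 2 μ_0 α_0 e^t` is nondecreasing.
  have hlow : μ 0 / 2 - 2 * μ 0 * (α 0 * Real.exp t) ≤ q t := by
    have h1 := mul_exp_le_of_deriv_ge (k := 0) ht.1
      (fun s hs' => (hf.deriv_q_Icc le_rfl hs').add
        (((Real.hasDerivAt_exp s).const_mul (2 * μ 0 * α 0)).hasDerivWithinAt))
      (fun s hs' => by
        have h2 := (hs.deriv_gap_le hp hf hM' hs').2
        have h3 := (abs_le.1 (hs.abs_q_le hp hf hM' hs')).2
        rw [pow_zero, one_mul, one_mul] at h2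
        have h4 : 0 ≤ 2 * (μ 0 / (1 - η)) * (amplitude η - q s) := by
          have : 0 < 1 - η := by linarith
          have : 0 ≤ amplitude η - q s := by linarith
          positivity
        linarith)
    have h5 := (hf.q_zero_bounds hp).1
    simp only [Pi.add_apply, neg_zero, zero_mul, Real.exp_zero, mul_one] at h1
    nlinarith [hp.alpha_pos 0]
  -- With `X = α_0 e^t`, the bounds `X ≤ 1/2 - q` and `hlow` give `(1 - 2μ_0) X ≤ (1 - μ_0)/2`; the
  -- worst case is `μ_0 = 1/4`.
  have hX34 : α 0 * Real.exp t ≤ 3 / 4 := by nlinarith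
  have hsmall : ∀ i, 1 ≤ i → α i * Real.exp t ≤ μ 0 * (α 0 * Real.exp t) := by
    intro i hi
    have h5 := (hp.alpha_antitone hi).trans (hp.alpha_succ_le 0)
    linarith [mul_le_mul_of_nonneg_right h5 he.le]
  have hyj := hs.eq_exp hp hf hM ht j (Nat.zero_le j)
  have hαj := mul_pos (hp.alpha_pos j) he
  rw [abs_le]
  constructor
  -- Here `y_j ≥ q - μ_0 X ≥ μ_0/2 - 3 μ_0 X ≥ -7μ_0/4 ≥ -7/16`, which is the origin of the margin
  -- `η/16`.
  · have h6 := neg_abs_le ((-1) ^ j * (α j * Real.exp t))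
    rw [abs_neg_one_pow_mul, abs_of_pos hαj] at h6
    have h7 := hsmall j hj
    nlinarith
  · have h8 : η / 2 ≤ η / (1 + η) :=
      div_le_div_of_nonneg_left hη.le (by linarith) (by linarith)
    have h9 := hp.amplitude_eq
    -- Odd cells lie below `q`; an even `j` is at least `2`, so the recursion for `α` supplies the
    -- factor `μ_1 ≤ η/4`.
    have h10 : (-1) ^ j * α j * Real.exp t ≤ η / 4 := by
      rcases Nat.even_or_odd j with hev | hod
      · have hj2 : 2 ≤ j := by
          obtain ⟨r, rfl⟩ := hev
          omega
        rw [hev.neg_one_pow, one_mul]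
        have h11 := (hp.alpha_antitone hj2).trans (hp.alpha_succ_le 1)
        have h12 := mul_le_mul_of_nonneg_right h11 he.le
        have h13 := hsmall 1 le_rfl
        have h14 : α 1 * Real.exp t ≤ 1 := by nlinarith
        have h15 := mul_le_mul h14 (hp.mu_succ_le 0) (hp.mu_pos 1).le zero_le_one
        linarith
      · rw [hod.neg_one_pow]
        linarith
    linarith

theorem abs_later_le (hp : Params η μ α) (hf : ReducedFlow μ α q F y)
    (hs : Stage η q y n a) (hn : n = 0 → a = 0) (hM : MiddleOn q y n a b) (ht : t ∈ Icc a b)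
    {j : ℕ} (hj : n < j) : |y j t| ≤ 1 / 2 - η / 16 := by
  rcases eq_or_ne n 0 with rfl | h
  · obtain rfl := hn rfl
    exact abs_later_le_of_zero hp hf hM ht hj
  · exact hs.abs_later_le_of_pos hp hf h hM ht hj

/-- The times at which some cell `≥ n` or the middle cell is not in the open middle phase. -/
def exitSet (q : ℝ → ℝ) (y : ℕ → ℝ → ℝ) (n : ℕ) (a : ℝ) : Set ℝ :=
  {t | a ≤ t ∧ (1 / 2 ≤ |q t| ∨ ∃ j, n ≤ j ∧ 1 / 2 ≤ |y j t|)}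

theorem exitSet_nonempty (hp : Params η μ α) (hf : ReducedFlow μ α q F y)
    (hs : Stage η q y n a) : (exitSet q y n a).Nonempty := by
  by_contra! hempty
  have hM : ∀ b, MiddleOn q y n a b := by
    intro b t ht
    have : t ∉ exitSet q y n a := by simp [hempty]
    simp only [exitSet, mem_ofPred_eq, not_and, not_or, not_exists, not_le] at this
    exact ⟨(this ht.1).1.le, fun j hj => ((this ht.1).2 j hj).le⟩
  have hα := hp.alpha_pos n
  -- At this time `e^t ≥ 1 + t` already forces `α_n e^t > 1`, impossible while cell `n` is inside.
  have hle : a ≤ a + 1 / α n := by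
    have : 0 < 1 / α n := by positivity
    linarith
  have h1 := hs.alpha_mul_exp_le_one hp hf (hM (a + 1 / α n)) (right_mem_Icc.2 hle)
  have h2 := Real.add_one_le_exp (a + 1 / α n)
  have h3 := mul_le_mul_of_nonneg_left h2 hα.le
  have h4 : α n * (a + 1 / α n + 1) = α n * a + 1 + α n := by
    field_simp
  have h5 := mul_nonneg hα.le hs.nonneg
  linarith

/-- Cell `n` leaves the middle phase in finite time, through the side of sign `(-1) ^ n`, and all
later cells are still inside at that time. -/
theorem exists_exit (hp : Params η μ α) (hf : ReducedFlow μ α q F y)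
    (hs : Stage η q y n a) (hn : n = 0 → a = 0) :
    ∃ b, a < b ∧ MiddleOn q y n a b ∧ (∀ t ∈ Ico a b, |y n t| < 1 / 2) ∧
      (-1) ^ n * y n b = 1 / 2 ∧ Stage η q y (n + 1) b := by
  set B := exitSet q y n a with hB
  have hne : B.Nonempty := hs.exitSet_nonempty hp hf
  have hbdd : BddBelow B := ⟨a, fun t ht => ht.1⟩
  set b := sInf B with hb
  have hab : a ≤ b := le_csInf hne fun t ht => ht.1
  have hb0 : 0 ≤ b := hs.nonneg.trans hab
  have hin : ∀ t ∈ Ico a b, |q t| < 1 / 2 ∧ ∀ j, n ≤ j → |y j t| < 1 / 2 := by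
    intro t ht
    have : t ∉ B := notMem_of_lt_csInf ht.2 hbdd
    simp only [hB, exitSet, mem_ofPred_eq, not_and, not_or, not_exists, not_le] at this
    exact this ht.1
  have hclosed : ∀ z : ℝ → ℝ, (∀ s t, 0 ≤ s → s ≤ t → |z t - z s| ≤ t - s) →
      |z a| < 1 / 2 → (∀ t ∈ Ico a b, |z t| < 1 / 2) → |z b| ≤ 1 / 2 := by
    intro z hz hza hzt
    rcases hab.eq_or_lt with h | h
    · rw [← h]
      exact hza.le
    · refine le_of_forall_pos_le_add fun ε hε => ?_
      have h1 : max a (b - ε) ∈ Ico a b := ⟨le_max_left _ _, max_lt h (by linarith)⟩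
      have h2 := hzt _ h1
      have h3 := hz _ b (hs.nonneg.trans h1.1) h1.2.le
      have h4 := abs_sub_abs_le_abs_sub (z b) (z (max a (b - ε)))
      have h5 := le_max_right a (b - ε)
      linarith
  have hLq : ∀ s t, 0 ≤ s → s ≤ t → |q t - q s| ≤ t - s := fun s t h1 h2 =>
    ReducedFlow.abs_sub_le_of_flow hf.deriv_q hf.box_q hf.box_F h1 h2
  have hLy : ∀ j s t, 0 ≤ s → s ≤ t → |y j t - y j s| ≤ t - s := fun j s t h1 h2 =>
    ReducedFlow.abs_sub_le_of_flow (hf.deriv_y j) (hf.box_y j) hf.box_F h1 h2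
  have ha : a ∈ Icc 0 a := ⟨hs.nonneg, le_rfl⟩
  have hM : MiddleOn q y n a b := by
    intro t ht
    rcases ht.2.eq_or_lt with rfl | h
    · exact ⟨hclosed q hLq ((hs.q_le a ha).trans_lt hp.amplitude_lt) fun t ht => (hin t ht).1,
        fun j hj => hclosed (y j) (hLy j) (hs.y_lt j hj a ha) fun t ht => (hin t ht).2 j hj⟩
    · exact ⟨(hin t ⟨ht.1, h⟩).1.le, fun j hj => ((hin t ⟨ht.1, h⟩).2 j hj).le⟩
  have hbm : b ∈ Icc a b := ⟨hab, le_rfl⟩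
  have hqb := hs.abs_q_le hp hf hM hbm
  have hlate : ∀ t ∈ Icc a b, ∀ j, n < j → |y j t| ≤ 1 / 2 - η / 16 := fun t ht j hj =>
    hs.abs_later_le hp hf hn hM ht hj
  have hη := hp.eta_pos
  have hexit : 1 / 2 ≤ |y n b| := by
    -- Every value moves at speed at most `1`, and at time `b` the middle cell, the later cells and
    -- cell `n` all have margins, uniform over the infinitely many later cells. No exit could then
    -- occur shortly after `b`.
    by_contra! hlt
    obtain ⟨t, htB, htlt⟩ := exists_lt_of_csInf_lt hne
      (show sInf B < b + min (1 / 2 - amplitude η) (min (η / 16) (1 / 2 - |y n b|)) by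
        have := lt_min (sub_pos.2 hp.amplitude_lt)
          (lt_min (show 0 < η / 16 by positivity) (sub_pos.2 hlt))
        linarith)
    have hbt : b ≤ t := csInf_le hbdd htB
    have h1 := min_le_left (1 / 2 - amplitude η) (min (η / 16) (1 / 2 - |y n b|))
    have h2 := min_le_right (1 / 2 - amplitude η) (min (η / 16) (1 / 2 - |y n b|))
    have h3 := min_le_left (η / 16) (1 / 2 - |y n b|)
    have h4 := min_le_right (η / 16) (1 / 2 - |y n b|)
    rcases htB.2 with h | ⟨j, hj, h⟩
    · have h5 := hLq b t hb0 hbt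
      have h6 := abs_sub_abs_le_abs_sub (q t) (q b)
      linarith
    · have h5 := hLy j b t hb0 hbt
      have h6 := abs_sub_abs_le_abs_sub (y j t) (y j b)
      rcases hj.eq_or_lt with rfl | hj
      · linarith
      · have h7 := hlate b hbm j hj
        linarith
  have hsign : (-1) ^ n * y n b = 1 / 2 := by
    have h1 : |y n b| = 1 / 2 := le_antisymm ((hM b hbm).2 n le_rfl) hexit
    have h2 := hs.alpha_mul_exp hp hf hM hbm
    have h3 := mul_pos (hp.alpha_pos n) (Real.exp_pos b)
    rw [← abs_neg_one_pow_mul n] at h1 hqb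
    have h4 := (abs_le.1 hqb).1
    have h5 := hp.amplitude_lt
    -- On the wrong side, `α_n e^b > 0` would put `(-1)^n q` below `-1/2`.
    rcases (abs_eq (by norm_num)).1 h1 with h | h
    · exact h
    · linarith
  have hlt : a < b := by
    refine lt_of_le_of_ne hab fun h => ?_
    have := hs.y_lt n le_rfl a ha
    rw [h] at this
    linarith
  refine ⟨b, hlt, hM, fun t ht => (hin t ht).2 n le_rfl, hsign, hb0, ?_, ?_, ?_⟩
  · intro t ht
    rcases le_total t a with h | h
    · exact hs.q_le t ⟨ht.1, h⟩
    · exact hs.abs_q_le hp hf hM ⟨h, ht.2⟩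
  · intro j hj t ht
    rcases le_total t a with h | h
    · exact hs.y_lt j (by omega) t ⟨ht.1, h⟩
    · have := hlate t ⟨h, ht.2⟩ j (by omega)
      linarith
  · intro j hj
    rcases (Nat.lt_succ_iff.1 hj).eq_or_lt with rfl | h
    · exact hsign.ge
    · exact hs.outer_of_le hf hab j h

end Stage

/-- The times `a n` at which stage `n` begins. -/
structure StageTimes (η : ℝ) (q : ℝ → ℝ) (y : ℕ → ℝ → ℝ) (a : ℕ → ℝ) : Prop where
  stage : ∀ n, Stage η q y n (a n)
  lt_succ : ∀ n, a n < a (n + 1)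
  middle : ∀ n, MiddleOn q y n (a n) (a (n + 1))
  y_lt : ∀ n, ∀ t ∈ Ico (a n) (a (n + 1)), |y n t| < 1 / 2
  exit_eq : ∀ n, (-1) ^ n * y n (a (n + 1)) = 1 / 2

theorem exists_stageTimes (hp : Params η μ α) (hf : ReducedFlow μ α q F y) :
    ∃ a, StageTimes η q y a := by
  -- The clause `n = 0 → a = 0` is carried along because the bound on later cells in stage `0`
  -- relies on the initial data.
  have hstep : ∀ (n : ℕ) (s : {a : ℝ // Stage η q y n a ∧ (n = 0 → a = 0)}),
      ∃ b : {a : ℝ // Stage η q y (n + 1) a ∧ (n + 1 = 0 → a = 0)},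
        s.1 < b.1 ∧ MiddleOn q y n s.1 b.1 ∧ (∀ t ∈ Ico s.1 b.1, |y n t| < 1 / 2) ∧
          (-1) ^ n * y n b.1 = 1 / 2 := by
    rintro n ⟨a, hs, hn⟩
    obtain ⟨b, h1, h2, h3, h4, h5⟩ := hs.exists_exit hp hf hn
    exact ⟨⟨b, h5, by simp⟩, h1, h2, h3, h4⟩
  choose g hg using hstep
  let A : (n : ℕ) → {a : ℝ // Stage η q y n a ∧ (n = 0 → a = 0)} := fun n =>
    Nat.rec ⟨0, stage_zero hp hf, fun _ => rfl⟩ (fun n s => g n s) n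
  exact ⟨fun n => (A n).1, fun n => (A n).2.1, fun n => (hg n (A n)).1,
    fun n => (hg n (A n)).2.1, fun n => (hg n (A n)).2.2.1, fun n => (hg n (A n)).2.2.2⟩

end Stages

/-! ### Long-time behaviour of the reduced system -/

section Asymptotics

/-- Solutions of `z' = -z + e` with `e → 0` tend to zero. -/
theorem tendsto_zero_of_deriv_eq {z e : ℝ → ℝ} {T : ℝ}
    (hz : ∀ t, T ≤ t → HasDerivWithinAt z (-z t + e t) (Ici T) t)
    (he : Tendsto e atTop (𝓝 0)) : Tendsto z atTop (𝓝 0) := by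
  have key : ∀ {z e : ℝ → ℝ}, (∀ t, T ≤ t → HasDerivWithinAt z (-z t + e t) (Ici T) t) →
      Tendsto e atTop (𝓝 0) → ∀ ε > 0, ∀ᶠ t in atTop, z t < ε := by
    intro z e hz he ε hε
    have h1 : ∀ᶠ t in atTop, e t < ε / 2 := he.eventually (gt_mem_nhds (by linarith))
    obtain ⟨T', hT'⟩ := eventually_atTop.1 (h1.and (eventually_ge_atTop T))
    have hTT' : T ≤ T' := (hT' T' le_rfl).2
    have h2 : Tendsto (fun t => (z T' - ε / 2) * Real.exp (-1 * (t - T'))) atTop (𝓝 0) := by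
      have h3 : Tendsto (fun t : ℝ => -1 * (t - T')) atTop atBot :=
        (tendsto_atTop_add_const_right _ (-T') tendsto_id).const_mul_atTop_of_neg
          (by norm_num)
      simpa using (Real.tendsto_exp_atBot.comp h3).const_mul (z T' - ε / 2)
    filter_upwards [h2.eventually (gt_mem_nhds (show (0 : ℝ) < ε / 2 by linarith)),
      eventually_ge_atTop T'] with t ht htT'
    have h4 := le_mul_exp_of_deriv_le (p := fun t => z t - ε / 2) (k := 1) htT'
      (fun s hs => ((hz s (hTT'.trans hs.1)).mono
        (fun r hr => hTT'.trans hr.1 : Icc T' t ⊆ Ici T)).sub_const (ε / 2))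
      (fun s hs => by
        have := (hT' s hs.1).1
        linarith)
    linarith
  rw [Metric.tendsto_nhds]
  intro ε hε
  filter_upwards [key hz he ε hε, key (z := fun t => -z t) (e := fun t => -e t)
    (fun t ht => (hz t ht).neg.congr_deriv (by ring)) (by simpa using he.neg) ε hε] with t h1 h2
  rw [Real.dist_eq, sub_zero, abs_lt]
  constructor <;> linarith

variable {η : ℝ} {μ α : ℕ → ℝ} {q F : ℝ → ℝ} {y : ℕ → ℝ → ℝ} {a : ℕ → ℝ}

namespace StageTimes

theorem strictMono (h : StageTimes η q y a) : StrictMono a := strictMono_nat_of_lt_succ h.lt_succ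

theorem nonneg (h : StageTimes η q y a) (n : ℕ) : 0 ≤ a n := (h.stage n).nonneg

theorem right_mem (h : StageTimes η q y a) (n : ℕ) : a (n + 1) ∈ Icc (a n) (a (n + 1)) :=
  right_mem_Icc.2 (h.lt_succ n).le

theorem alpha_mul_exp_ge (hp : Params η μ α) (hf : ReducedFlow μ α q F y)
    (h : StageTimes η q y a) (n : ℕ) :
    1 / 2 - amplitude η ≤ α n * Real.exp (a (n + 1)) := by
  rw [(h.stage n).alpha_mul_exp hp hf (h.middle n) (h.right_mem n), h.exit_eq n]
  have h1 := (h.stage n).abs_q_le hp hf (h.middle n) (h.right_mem n)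
  rw [← abs_neg_one_pow_mul n, abs_le] at h1
  linarith [h1.2]

/-- Were the exit times bounded, `α_n e^{a(n+1)}` would tend to `0` with `α`, against its positive
lower bound. -/
theorem tendsto_atTop (hp : Params η μ α) (hf : ReducedFlow μ α q F y)
    (h : StageTimes η q y a) : Tendsto a atTop atTop := by
  refine tendsto_atTop_atTop_of_monotone h.strictMono.monotone fun C => ?_
  by_contra! hC
  have h1 : Tendsto (fun n => α n * Real.exp C) atTop (𝓝 0) := by
    simpa using hp.tendsto_alpha.mul_const (Real.exp C)
  have h2 : 1 / 2 - amplitude η ≤ 0 := ge_of_tendsto' h1 fun n =>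
    (h.alpha_mul_exp_ge hp hf n).trans
      (mul_le_mul_of_nonneg_left (Real.exp_le_exp.2 (hC (n + 1)).le) (hp.alpha_pos n).le)
  linarith [hp.amplitude_lt]

theorem abs_q_le (hp : Params η μ α) (hf : ReducedFlow μ α q F y)
    (h : StageTimes η q y a) {t : ℝ} (ht : 0 ≤ t) : |q t| ≤ amplitude η := by
  obtain ⟨n, hn⟩ := ((h.tendsto_atTop hp hf).eventually (eventually_ge_atTop t)).exists
  exact (h.stage n).q_le t ⟨ht, hn⟩

theorem middle_of_lt (h : StageTimes η q y a) {j : ℕ} {t : ℝ} (ht : 0 ≤ t)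
    (htj : t < a (j + 1)) : |y j t| < 1 / 2 := by
  rcases le_total t (a j) with h1 | h1
  · exact (h.stage j).y_lt j le_rfl t ⟨ht, h1⟩
  · exact h.y_lt j t ⟨h1, htj⟩

theorem outer_of_ge (hf : ReducedFlow μ α q F y) (h : StageTimes η q y a) {j n : ℕ} (hjn : j < n)
    {t : ℝ} (ht : a n ≤ t) : 1 / 2 ≤ (-1) ^ j * y j t :=
  (h.stage n).outer_of_le hf ht j hjn

theorem tendsto_force_add (hp : Params η μ α) (hf : ReducedFlow μ α q F y)
    (h : StageTimes η q y a) : Tendsto (fun t => F t + q t) atTop (𝓝 0) := by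
  rw [Metric.tendsto_nhds]
  intro ε hε
  have h1 : Tendsto (fun n => μ n / (1 - η) * 3) atTop (𝓝 0) := by
    simpa using (hp.tendsto_mu.div_const (1 - η)).mul_const 3
  obtain ⟨n, hn⟩ := (h1.eventually (gt_mem_nhds hε)).exists
  filter_upwards [eventually_ge_atTop (a n)] with t ht
  rw [Real.dist_eq, sub_zero]
  have h0 := (h.nonneg n).trans ht
  exact (hf.abs_force_add_le hp h0 ((h.abs_q_le hp hf h0).trans hp.amplitude_lt.le)
    fun j hj => h.outer_of_ge hf hj ht).trans_lt hn

/-- A cell in the outer phase of sign `(-1) ^ n` approaches the branch `(-1) ^ n - q`. -/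
theorem tendsto_outer (hp : Params η μ α) (hf : ReducedFlow μ α q F y)
    (h : StageTimes η q y a) {z : ℝ → ℝ} {T : ℝ} (hT : 0 ≤ T) (n : ℕ)
    (hz : ∀ t, 0 ≤ t → HasDerivWithinAt z (-fPL (z t) + F t) (Ici 0) t)
    (hout : 1 / 2 ≤ (-1) ^ n * z T) :
    Tendsto (fun t => z t - ((-1) ^ n - q t)) atTop (𝓝 0) := by
  refine tendsto_zero_of_deriv_eq (T := T) (e := fun t => 2 * (F t + q t)) (fun t ht => ?_)
    (by simpa using (h.tendsto_force_add hp hf).const_mul 2)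
  have h0 := hT.trans ht
  have h1 := fPL_of_ge (outer_phase_invariant n hz hf.box_F hT ht hout)
  rw [fPL_neg_one_pow_mul] at h1
  have h2 : fPL (z t) = z t - (-1) ^ n := by
    linear_combination (-1) ^ n * h1 + (z t - fPL (z t)) * neg_one_pow_mul_self n
  refine (((hz t h0).sub ((hf.deriv_q t h0).const_sub ((-1) ^ n))).mono
    (Ici_subset_Ici.2 hT)).congr_deriv ?_
  rw [h2, fPL_of_abs_le ((h.abs_q_le hp hf h0).trans hp.amplitude_lt.le)]
  ring

/-- Subtracting the primitive `2 μ_n α_n e^t` of the forcing from the gap leaves a quantity decaying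
at rate `2 μ_n/(1-η)`, at most `1` initially; the subtracted term is at most `2 μ_n` at the exit. -/
theorem gap_le (hp : Params η μ α) (hf : ReducedFlow μ α q F y)
    (h : StageTimes η q y a) (n : ℕ) :
    amplitude η - (-1) ^ n * q (a (n + 1)) ≤
      2 * μ n + Real.exp (-(2 * (μ n / (1 - η))) * (a (n + 1) - a n)) := by
  have hs := h.stage n
  have hM := h.middle n
  have h1 := le_mul_exp_of_deriv_le (k := 2 * (μ n / (1 - η))) (h.lt_succ n).le
    (fun t ht => (((hf.deriv_q_Icc hs.nonneg ht).const_mul ((-1) ^ n)).const_sub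
      (amplitude η)).sub (((Real.hasDerivAt_exp t).const_mul (2 * μ n * α n)).hasDerivWithinAt))
    (fun t ht => by
      have h2 := (hs.deriv_gap_le hp hf hM ht).2
      have h3 : 0 ≤ 2 * (μ n / (1 - η)) * (2 * μ n * α n * Real.exp t) := by
        have := sub_pos.2 hp.eta_lt
        have := hp.mu_pos n
        have := hp.alpha_pos n
        positivity
      simp only [Pi.sub_apply]
      linarith)
  simp only [Pi.sub_apply] at h1
  have h4 := hs.alpha_mul_exp_le_one hp hf hM (h.right_mem n)
  have h5 := hs.q_le (a n) ⟨hs.nonneg, le_rfl⟩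
  rw [← abs_neg_one_pow_mul n, abs_le] at h5
  have h6 := hp.amplitude_lt
  have h7 : amplitude η - (-1) ^ n * q (a n) - 2 * μ n * α n * Real.exp (a n) ≤ 1 := by
    have : 0 ≤ 2 * μ n * α n * Real.exp (a n) := by
      have := hp.mu_pos n
      have := hp.alpha_pos n
      positivity
    linarith [h5.1]
  have h8 := mul_le_mul_of_nonneg_right h7
    (Real.exp_pos (-(2 * (μ n / (1 - η))) * (a (n + 1) - a n))).le
  have h9 := mul_le_mul_of_nonneg_left h4 (mul_pos two_pos (hp.mu_pos n)).le
  linarith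

/-- The growth condition under which every stage lasts long compared to its relaxation time. -/
def _root_.NonlocalODE.FastDecay (μ α : ℕ → ℝ) : Prop :=
  ∃ β : ℕ → ℝ, (∀ j, 0 < β j) ∧ Antitone β ∧ Tendsto β atTop (𝓝 0) ∧
    ∀ᶠ j in atTop, α (j + 1) ≤ α j * μ j * β j ^ (1 / μ j)

/-- Two successive exits compare `α_{n+1} e^{a(n+2)} ≥ c` with `α_n e^{a(n+1)} ≤ 1`. Taking
logarithms and multiplying by `μ_n` turns `β_n^{1/μ_n}` into `log β_n → -∞`, which explains the
exponent in the hypothesis. -/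
theorem tendsto_mu_mul_duration (hp : Params η μ α) (hf : ReducedFlow μ α q F y)
    (h : StageTimes η q y a) (hβ : FastDecay μ α) :
    Tendsto (fun n => μ n * (a (n + 2) - a (n + 1))) atTop atTop := by
  obtain ⟨β, hpos, -, hlim, hle⟩ := hβ
  set c := 1 / 2 - amplitude η with hc
  have hcpos : 0 < c := sub_pos.2 hp.amplitude_lt
  have h1 : Tendsto (fun n => μ n * Real.log c + -Real.log (β n)) atTop atTop := by
    refine (hp.tendsto_mu.mul_const (Real.log c)).add_atTop (tendsto_neg_atBot_atTop.comp ?_)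
    exact Real.tendsto_log_nhdsGT_zero.comp
      (tendsto_nhdsWithin_iff.2 ⟨hlim, Eventually.of_forall hpos⟩)
  refine tendsto_atTop_mono' _ ?_ h1
  filter_upwards [hle] with n hn
  have hμ := hp.mu_pos n
  have h2 := h.alpha_mul_exp_ge hp hf (n + 1)
  have h3 := (h.stage n).alpha_mul_exp_le_one hp hf (h.middle n) (h.right_mem n)
  have hb := Real.rpow_pos_of_pos (hpos n) (1 / μ n)
  have h4 : c ≤ β n ^ (1 / μ n) * Real.exp (a (n + 2) - a (n + 1)) := by
    have h5 : Real.exp (a (n + 2)) =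
        Real.exp (a (n + 1)) * Real.exp (a (n + 2) - a (n + 1)) := by
      rw [← Real.exp_add]
      ring_nf
    set E := Real.exp (a (n + 2) - a (n + 1)) with hE
    have hEpos : 0 < E := Real.exp_pos _
    have h6 : α n * Real.exp (a (n + 1)) * μ n ≤ 1 := by
      nlinarith [hp.mu_le_quarter n, mul_pos (hp.alpha_pos n) (Real.exp_pos (a (n + 1)))]
    calc c ≤ α (n + 1) * Real.exp (a (n + 2)) := h2
      _ ≤ α n * μ n * β n ^ (1 / μ n) * Real.exp (a (n + 2)) := by gcongr
      _ = (α n * Real.exp (a (n + 1)) * μ n) * (β n ^ (1 / μ n) * E) := by rw [h5]; ring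
      _ ≤ 1 * (β n ^ (1 / μ n) * E) := by gcongr
      _ = β n ^ (1 / μ n) * E := one_mul _
  have h7 := Real.log_le_log hcpos h4
  rw [Real.log_mul hb.ne' (Real.exp_pos _).ne', Real.log_exp, Real.log_rpow (hpos n)] at h7
  have h8 := mul_le_mul_of_nonneg_left h7 hμ.le
  have h9 : μ n * (1 / μ n * Real.log (β n) + (a (n + 2) - a (n + 1))) =
      Real.log (β n) + μ n * (a (n + 2) - a (n + 1)) := by
    field_simp
  linarith

/-- At the end of stage `n`, the value of `(-1) ^ n q` is close to the amplitude. -/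
theorem tendsto_peak (hp : Params η μ α) (hf : ReducedFlow μ α q F y)
    (h : StageTimes η q y a) (hβ : FastDecay μ α) :
    Tendsto (fun n => (-1) ^ n * q (a (n + 1))) atTop (𝓝 (amplitude η)) := by
  rw [← tendsto_add_atTop_iff_nat 1]
  have hη := hp.eta_pos
  have hη1 := sub_pos.2 hp.eta_lt
  have h1 : Tendsto (fun n => -(2 * (μ (n + 1) / (1 - η))) * (a (n + 1 + 1) - a (n + 1)))
      atTop atBot := by
    have h2 := (h.tendsto_mu_mul_duration hp hf hβ).const_mul_atTop_of_neg
      (show -(2 * (η / (1 - η))) < 0 by rw [neg_lt_zero]; positivity)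
    refine h2.congr fun n => ?_
    rw [hp.mu_succ]
    ring
  have h3 : Tendsto (fun n => amplitude η - (2 * μ (n + 1) +
      Real.exp (-(2 * (μ (n + 1) / (1 - η))) * (a (n + 1 + 1) - a (n + 1)))))
      atTop (𝓝 (amplitude η)) := by
    have h4 := ((hp.tendsto_mu.comp (tendsto_add_atTop_nat 1)).const_mul 2).add
      (Real.tendsto_exp_atBot.comp h1)
    simpa using h4.const_sub (amplitude η)
  refine tendsto_of_tendsto_of_tendsto_of_le_of_le h3 tendsto_const_nhds (fun n => ?_) fun n => ?_
  · have := h.gap_le hp hf (n + 1)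
    simp only
    linarith
  · have h5 := h.abs_q_le hp hf (h.nonneg (n + 1 + 1))
    rw [← abs_neg_one_pow_mul (n + 1)] at h5
    exact (abs_le.1 h5).2

theorem tendsto_peak_even (hp : Params η μ α) (hf : ReducedFlow μ α q F y)
    (h : StageTimes η q y a) (hβ : FastDecay μ α) :
    Tendsto (fun n => q (a (2 * n + 1))) atTop (𝓝 (amplitude η)) := by
  have h1 := (h.tendsto_peak hp hf hβ).comp
    (tendsto_atTop_mono (fun n => by dsimp; omega) tendsto_id : Tendsto (fun n => 2 * n) atTop atTop)
  refine h1.congr fun n => ?_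
  simp

theorem tendsto_peak_odd (hp : Params η μ α) (hf : ReducedFlow μ α q F y)
    (h : StageTimes η q y a) (hβ : FastDecay μ α) :
    Tendsto (fun n => q (a (2 * n + 2))) atTop (𝓝 (-amplitude η)) := by
  have h1 := (h.tendsto_peak hp hf hβ).comp
    (tendsto_atTop_mono (fun n => by dsimp; omega) tendsto_id : Tendsto (fun n => 2 * n + 1) atTop atTop)
  refine h1.neg.congr fun n => ?_
  simp [pow_succ]

theorem exists_tendsto_q (hp : Params η μ α) (hf : ReducedFlow μ α q F y)
    (h : StageTimes η q y a) (hβ : FastDecay μ α) {s : ℝ} (hs : |s| ≤ amplitude η) :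
    ∃ t : ℕ → ℝ, Tendsto t atTop atTop ∧ Tendsto (fun n => q (t n)) atTop (𝓝 s) := by
  -- The target `s` is clamped between the values at two successive peaks, so the intermediate value
  -- theorem applies for every `n`; the clamp disappears in the limit.
  have h1 : ∀ n, ∃ t, a (2 * n + 1) ≤ t ∧
      q t = max (min s (q (a (2 * n + 1)))) (q (a (2 * n + 2))) := by
    intro n
    have hlt := h.lt_succ (2 * n + 1)
    have hc : ContinuousOn q (uIcc (a (2 * n + 1)) (a (2 * n + 2))) := by
      rw [uIcc_of_le hlt.le]
      exact hf.continuousOn_q.mono fun t ht => (h.nonneg _).trans ht.1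
    have hmem : max (min s (q (a (2 * n + 1)))) (q (a (2 * n + 2))) ∈
        uIcc (q (a (2 * n + 1))) (q (a (2 * n + 2))) := by
      rw [mem_uIcc]
      rcases le_total (q (a (2 * n + 1))) (q (a (2 * n + 2))) with hle | hle
      · exact Or.inl ⟨hle.trans (le_max_right _ _),
          max_le ((min_le_right _ _).trans hle) le_rfl⟩
      · exact Or.inr ⟨le_max_right _ _, max_le (min_le_right _ _) hle⟩
    obtain ⟨t, ht, hqt⟩ := intermediate_value_uIcc hc hmem
    rw [uIcc_of_le hlt.le] at ht
    exact ⟨t, ht.1, hqt⟩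
  choose t ht hqt using h1
  refine ⟨t, tendsto_atTop_mono ht ((h.tendsto_atTop hp hf).comp
    (tendsto_atTop_mono (fun n => by dsimp; omega) tendsto_id)), ?_⟩
  simp_rw [hqt]
  have h2 := ((tendsto_const_nhds (x := s)).min (h.tendsto_peak_even hp hf hβ)).max
    (h.tendsto_peak_odd hp hf hβ)
  rw [abs_le] at hs
  rwa [min_eq_left hs.2, max_eq_left hs.1] at h2

theorem limsup_sub_liminf (hp : Params η μ α) (hf : ReducedFlow μ α q F y)
    (h : StageTimes η q y a) (hβ : FastDecay μ α) :
    limsup F atTop - liminf F atTop = (1 - η) / (1 + η) := by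
  have hF := h.tendsto_force_add hp hf
  have hq : ∀ᶠ t in atTop, |q t| ≤ amplitude η := by
    filter_upwards [eventually_ge_atTop 0] with t ht using h.abs_q_le hp hf ht
  have hbox : ∀ᶠ t in atTop, |F t| ≤ 1 / 2 := by
    filter_upwards [eventually_ge_atTop 0] with t ht using hf.box_F t ht
  have hub : IsBoundedUnder (· ≤ ·) atTop F :=
    isBoundedUnder_of_eventually_le (a := 1 / 2) (hbox.mono fun t ht => (abs_le.1 ht).2)
  have hlb : IsBoundedUnder (· ≥ ·) atTop F :=
    isBoundedUnder_of_eventually_ge (a := -(1 / 2)) (hbox.mono fun t ht => (abs_le.1 ht).1)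
  have hseq : ∀ s, |s| ≤ amplitude η → ∀ ε > 0, ∃ᶠ t in atTop, |F t + s| < ε := by
    intro s hs ε hε
    obtain ⟨t, ht, hqt⟩ := h.exists_tendsto_q hp hf hβ hs
    have h1 : Tendsto (fun n => F (t n) + s) atTop (𝓝 0) := by
      have h2 := (hF.comp ht).sub (hqt.sub_const s)
      simp only [sub_self] at h2
      exact h2.congr fun n => by simp only [Function.comp_apply]; ring
    have h3 : ∀ᶠ n in atTop, |F (t n) + s| < ε := by
      have := (Metric.tendsto_nhds.1 h1) ε hε
      simpa [Real.dist_eq] using this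
    exact ht.frequently h3.frequently
  have hA := hp.amplitude_pos
  -- As `F + q → 0`, the upper limit of `F` is reached along times with `q → -amplitude η`.
  have hsup : limsup F atTop = amplitude η := by
    refine le_antisymm ?_ ?_
    · refine le_of_forall_pos_le_add fun ε hε => ?_
      refine limsup_le_of_le hlb.isCoboundedUnder_le ?_
      filter_upwards [hq, hF.eventually (gt_mem_nhds hε)] with t h1 h2
      linarith [(abs_le.1 h1).1]
    · refine le_of_forall_pos_le_add fun ε hε => ?_
      rw [← sub_le_iff_le_add]
      refine le_limsup_of_frequently_le ?_ hub
      refine (hseq (-amplitude η) (by rw [abs_neg, abs_of_pos hA]) ε hε).mono fun t ht => ?_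
      linarith [(abs_lt.1 ht).1]
  have hinf : liminf F atTop = -amplitude η := by
    refine le_antisymm ?_ ?_
    · refine le_of_forall_pos_le_add fun ε hε => ?_
      refine liminf_le_of_frequently_le ?_ hlb
      refine (hseq (amplitude η) (by rw [abs_of_pos hA]) ε hε).mono fun t ht => ?_
      linarith [(abs_lt.1 ht).2]
    · refine le_of_forall_pos_le_add fun ε hε => ?_
      rw [← sub_le_iff_le_add]
      refine le_liminf_of_le hub.isCoboundedUnder_ge ?_
      filter_upwards [hq, hF.eventually (lt_mem_nhds (neg_lt_zero.2 hε))] with t h1 h2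
      linarith [(abs_le.1 h1).2]
  rw [hsup, hinf, amplitude]
  ring

end StageTimes

end Asymptotics

/-! ### Reduction from `Ω` to the countable space of cells -/

section Cells

/-- With the discrete structures every function of the cell is measurable and continuous, so the
bounded continuous functions are all bounded families indexed by cells. -/
instance : MeasurableSpace Cell := ⊤

instance : TopologicalSpace Cell := ⊥

instance : DiscreteTopology Cell := ⟨rfl⟩

instance : DiscreteMeasurableSpace Cell := ⟨fun _ => trivial⟩

/-- The cells consist of three big ones and a sequence. -/
def cellEquiv : Fin 3 ⊕ ℕ ≃ Cell where
  toFun := Sum.elim ![Cell.l, Cell.m, Cell.r] Cell.idx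
  invFun
    | .l => Sum.inl 0
    | .m => Sum.inl 1
    | .r => Sum.inl 2
    | .idx j => Sum.inr j
  left_inv := by
    rintro (i | j)
    · fin_cases i <;> rfl
    · rfl
  right_inv := by
    rintro (_ | _ | _ | j) <;> rfl

instance : Countable Cell := cellEquiv.symm.injective.countable

/-- The mean over the cells. -/
noncomputable def cellMean (μ : ℕ → ℝ) (g : Cell → ℝ) : ℝ :=
  cellMass μ .l * g .l + cellMass μ .m * g .m + cellMass μ .r * g .r + ∑' j, μ j * g (.idx j)

variable {Ω : Type*} [MeasurableSpace Ω] {ν : Measure Ω} {η : ℝ} {μ α : ℕ → ℝ}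
  {P : Cell → Set Ω} {κ : Ω → Cell}

/-- `κ` assigns to each point the label of its cell. -/
structure IsLabel (ν : Measure Ω) (μ : ℕ → ℝ) (P : Cell → Set Ω) (κ : Ω → Cell) : Prop where
  measurable : Measurable κ
  mem_iff : ∀ c x, x ∈ P c ↔ κ x = c
  mass : ∀ c, ν.real (P c) = cellMass μ c

theorem exists_isLabel (hPmeas : ∀ c, MeasurableSet (P c))
    (hPdisj : Pairwise (Function.onFun Disjoint P)) (hPcover : ⋃ c, P c = univ)
    (hPmass : ∀ c, ν.real (P c) = cellMass μ c) : ∃ κ, IsLabel ν μ P κ := by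
  have hex : ∀ x, ∃ c, x ∈ P c := fun x => mem_iUnion.1 (hPcover ▸ mem_univ x)
  choose κ hκ using hex
  have hmem : ∀ c x, x ∈ P c ↔ κ x = c := by
    intro c x
    refine ⟨fun hx => ?_, fun h => h ▸ hκ x⟩
    by_contra hne
    exact disjoint_left.1 (hPdisj hne) (hκ x) hx
  refine ⟨κ, measurable_to_countable' fun c => ?_, hmem, hPmass⟩
  have : κ ⁻¹' {c} = P c := by
    ext x
    simp [hmem]
  rw [this]
  exact hPmeas c

namespace IsLabel

theorem real_map_singleton (hκ : IsLabel ν μ P κ) (c : Cell) :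
    (ν.map κ).real {c} = cellMass μ c := by
  rw [map_measureReal_apply hκ.measurable (measurableSet_singleton c), ← hκ.mass]
  congr 1
  ext x
  simp [hκ.mem_iff]

theorem integral_map (hκ : IsLabel ν μ P κ) (g : Cell → ℝ) :
    ∫ c, g c ∂(ν.map κ) = ∫ x, g (κ x) ∂ν :=
  MeasureTheory.integral_map hκ.measurable.aemeasurable
    (measurable_of_countable g).aestronglyMeasurable

theorem integral_eq_cellMean [IsProbabilityMeasure ν] (hp : Params η μ α) (hκ : IsLabel ν μ P κ)
    {g : Cell → ℝ} {C : ℝ} (hg : ∀ c, |g c| ≤ C) :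
    ∫ c, g c ∂(ν.map κ) = cellMean μ g := by
  have : IsProbabilityMeasure (ν.map κ) :=
    Measure.isProbabilityMeasure_map hκ.measurable.aemeasurable
  have hint : Integrable g (ν.map κ) := Integrable.of_bound
    (measurable_of_countable g).aestronglyMeasurable C (Eventually.of_forall hg)
  rw [integral_countable hint]
  simp_rw [hκ.real_map_singleton, smul_eq_mul]
  rw [← cellEquiv.tsum_eq]
  have h1 : HasSum ((fun i => cellMass μ (cellEquiv i) * g (cellEquiv i)) ∘ Sum.inl)
      (cellMass μ .l * g .l + cellMass μ .m * g .m + cellMass μ .r * g .r) := by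
    convert hasSum_fintype ((fun i => cellMass μ (cellEquiv i) * g (cellEquiv i)) ∘ Sum.inl)
      using 1
    rw [Fin.sum_univ_three]
    rfl
  have h2 : HasSum ((fun i => cellMass μ (cellEquiv i) * g (cellEquiv i)) ∘ Sum.inr)
      (∑' j, μ j * g (.idx j)) :=
    (hp.summable_mul_mu fun j => hg (.idx j)).hasSum
  exact (h1.sum h2).tsum_eq

end IsLabel

theorem Params.cellMass_sub (hp : Params η μ α) :
    cellMass μ .r - cellMass μ .l = -(μ 0 / (1 + η)) := by
  have h1 := hp.hasSum_mu_alternating 0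
  simp only [zero_add] at h1
  have he : Summable fun k => μ (2 * k) :=
    hp.summable_mu.comp_injective fun i j h => by simpa using h
  have ho : Summable fun k => μ (2 * k + 1) :=
    hp.summable_mu.comp_injective fun i j h => by simpa using h
  have h2 : HasSum (fun k => (-1) ^ k * μ k) (∑' k, μ (2 * k) + -∑' k, μ (2 * k + 1)) := by
    refine HasSum.even_add_odd ?_ ?_
    · simpa using he.hasSum
    · simpa [pow_succ] using ho.hasSum.neg
  rw [h1.unique h2, cellMass, cellMass]
  ring

theorem Params.cellMean_cellValue (hp : Params η μ α) :
    cellMean μ (cellValue α) = tailForce μ α 0 - μ 0 / (1 + η) := by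
  have h1 := (hp.hasSum_tailForce 0).tsum_eq
  simp only [zero_add] at h1
  have h2 : ∑' j, μ j * ((-1) ^ j * α j) = tailForce μ α 0 := by
    rw [← h1]
    congr 1
    ext j
    ring
  have h3 := hp.cellMass_sub
  simp only [cellMean, cellValue]
  rw [h2]
  linarith

theorem Params.abs_cellMean_cellValue_le (hp : Params η μ α) :
    |cellMean μ (cellValue α)| ≤ 1 / 4 := by
  have h0 := hp.eta_pos
  have h1 := hp.tailForce_nonneg 0
  have h2 := hp.tailForce_le 0
  have h3 := hp.mu_zero_pos
  have h4 := hp.mu_zero_le_quarter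
  have h5 : μ 0 / (1 + η) ≤ μ 0 := div_le_self h3.le (by linarith)
  have h6 : 0 < μ 0 / (1 + η) := by positivity
  have h7 : α 0 * μ 0 ≤ 1 / 4 := by nlinarith [hp.alpha_zero_lt]
  rw [hp.cellMean_cellValue, abs_le]
  constructor <;> linarith

theorem Params.abs_cellValue_le (hp : Params η μ α) (c : Cell) : |cellValue α c| ≤ 1 := by
  cases c with
  | idx j =>
    rw [cellValue, abs_neg_one_pow_mul, abs_of_pos (hp.alpha_pos j)]
    linarith [hp.alpha_le_quarter j]
  | _ => simp [cellValue]

/-- The dynamics on the cells. -/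
structure CellFlow (μ α : ℕ → ℝ) (F : ℝ → ℝ) (y : Cell → ℝ → ℝ) : Prop where
  deriv : ∀ c t, 0 ≤ t → HasDerivWithinAt (y c) (-fPL (y c t) + F t) (Ici 0) t
  box : ∀ c t, 0 ≤ t → |y c t| ≤ 3 / 2
  force : ∀ t, 0 ≤ t → F t = cellMean μ fun c => fPL (y c t)
  mean : ∀ t, 0 ≤ t → cellMean μ (fun c => y c t) = 0
  initial : ∀ c, y c 0 = cellValue α c - cellMean μ (cellValue α)
  box_F : ∀ t, 0 ≤ t → |F t| ≤ 1 / 2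

theorem exists_cellFlow [IsProbabilityMeasure ν] (hp : Params η μ α) (hκ : IsLabel ν μ P κ) :
    ∃ F y, CellFlow μ α F y := by
  have : IsProbabilityMeasure (ν.map κ) :=
    Measure.isProbabilityMeasure_map hκ.measurable.aemeasurable
  set vbar := cellMean μ (cellValue α) with hvbar
  have hbound : ∀ c, |cellValue α c - vbar| ≤ 3 / 2 := fun c => by
    have h1 := abs_sub (cellValue α c) vbar
    linarith [hp.abs_cellValue_le c, hp.abs_cellMean_cellValue_le]
  obtain ⟨φ, hφ0, hφ, hbox, hmean⟩ := exists_boxed_flow (ν.map κ)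
    (BoundedContinuousFunction.ofNormedAddCommGroupDiscrete (fun c => cellValue α c - vbar) _
      hbound) hbound
  refine ⟨fun t => ∫ c, fPL (φ t c) ∂(ν.map κ), fun c t => φ t c, fun c t ht => hφ t ht c,
    fun c t ht => hbox t ht c, fun t ht => hκ.integral_eq_cellMean hp fun c =>
      abs_fPL_le (hbox t ht c), fun t ht => ?_, fun c => ?_, fun t ht => ?_⟩
  · rw [← hκ.integral_eq_cellMean hp fun c => hbox t ht c, hmean t ht]
    change ∫ c, (cellValue α c - vbar) ∂(ν.map κ) = 0
    rw [integral_sub (Integrable.of_bound (measurable_of_countable _).aestronglyMeasurable 1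
      (Eventually.of_forall hp.abs_cellValue_le)) (integrable_const _),
      hκ.integral_eq_cellMean hp hp.abs_cellValue_le]
    simp [hvbar]
  · simp only [hφ0]
    rfl
  · have := norm_integral_le_of_norm_le_const (μ := ν.map κ) (f := fun c => fPL (φ t c))
      (C := 1 / 2) (Eventually.of_forall fun c => abs_fPL_le (hbox t ht c))
    simpa using this

namespace CellFlow

variable {F : ℝ → ℝ} {y : Cell → ℝ → ℝ}

theorem left_zero (hp : Params η μ α) (hf : CellFlow μ α F y) :
    1 / 2 ≤ (-1) ^ 1 * y .l 0 := by
  have h := abs_le.1 hp.abs_cellMean_cellValue_le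
  rw [hf.initial, cellValue]
  linarith [h.1]

theorem right_zero (hp : Params η μ α) (hf : CellFlow μ α F y) :
    1 / 2 ≤ (-1) ^ 0 * y .r 0 := by
  have h := abs_le.1 hp.abs_cellMean_cellValue_le
  rw [hf.initial, cellValue]
  linarith [h.2]

/-- Subtracting the vanishing mean of `y` from the force leaves the mean of `f(y) - y`. The left and
right cells never change phase and contribute their mass difference, which is the alternating sum of
the `μ_j`. -/
theorem reducedFlow (hp : Params η μ α) (hf : CellFlow μ α F y) :
    ReducedFlow μ α (y .m) F fun j => y (.idx j) where
  deriv_q := hf.deriv .m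
  deriv_y j := hf.deriv (.idx j)
  box_q := hf.box .m
  box_y j := hf.box (.idx j)
  box_F := hf.box_F
  force t ht := by
    have h1 := hf.force t ht
    have h2 := hf.mean t ht
    have hl := outer_phase_invariant 1 (hf.deriv .l) hf.box_F le_rfl ht (hf.left_zero hp)
    have hr := outer_phase_invariant 0 (hf.deriv .r) hf.box_F le_rfl ht (hf.right_zero hp)
    have h3 := fPL_of_le (z := y .l t) (by linarith)
    have h4 := fPL_of_ge (z := y .r t) (by linarith)
    have hs1 := hp.summable_mul_mu (g := fun j => fPL (y (.idx j) t)) fun j =>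
      abs_fPL_le (hf.box (.idx j) t ht)
    have hs2 := hp.summable_mul_mu (g := fun j => y (.idx j) t) fun j => hf.box (.idx j) t ht
    have h5 := hp.hasSum_mu_alternating 0
    simp only [zero_add] at h5
    have h6 := (h5.add (hs1.hasSum.sub hs2.hasSum)).tsum_eq
    have h7 : ∑' j, μ j * ((-1) ^ j + (fPL (y (.idx j) t) - y (.idx j) t)) =
        ∑' j, ((-1) ^ j * μ j + (μ j * fPL (y (.idx j) t) - μ j * y (.idx j) t)) := by
      congr 1
      ext j
      ring
    have h8 := hp.cellMass_sub
    have hm : cellMass μ .m = 1 / 2 := rfl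
    rw [h7, h6]
    simp only [cellMean, h3, h4, hm] at h1 h2
    linarith
  init_q := by
    have h1 := (hp.hasSum_mu_alternating 0).sub (hp.hasSum_tailForce 0)
    simp only [zero_add] at h1
    have h2 : ∑' j, (-1) ^ j * (μ j * (1 - α j)) = μ 0 / (1 + η) - tailForce μ α 0 := by
      rw [← h1.tsum_eq]
      congr 1
      ext j
      ring
    rw [hf.initial, hp.cellMean_cellValue, h2, cellValue]
    ring
  init_y j := by
    rw [hf.initial, hf.initial, cellValue, cellValue]
    ring

/-- The solution on `Ω` induced by the dynamics on the cells. -/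
theorem isSolution [IsProbabilityMeasure ν] (hp : Params η μ α) (hκ : IsLabel ν μ P κ)
    (hf : CellFlow μ α F y) {v₀ : Ω → ℝ} (hv₀ : ∀ x, v₀ x = cellValue α (κ x)) :
    IsSolution ν fPL (fun x => v₀ x - ∫ y, v₀ y ∂ν) (fun t x => y (κ x) (max t 0)) ∧
      ∀ t, 0 ≤ t → meanForce ν fPL (fun t x => y (κ x) (max t 0)) t = F t := by
  have hmean : ∀ t, 0 ≤ t → meanForce ν fPL (fun t x => y (κ x) (max t 0)) t = F t := by
    intro t ht
    rw [hf.force t ht, ← hκ.integral_eq_cellMean hp (fun c => abs_fPL_le (hf.box c t ht)),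
      hκ.integral_map, meanForce]
    simp only [max_eq_left ht]
  have hv : ∫ x, v₀ x ∂ν = cellMean μ (cellValue α) := by
    rw [← hκ.integral_eq_cellMean hp hp.abs_cellValue_le, hκ.integral_map]
    simp only [hv₀]
  refine ⟨⟨fun t _ => (measurable_of_countable fun c => y c (max t 0)).comp hκ.measurable,
    fun T => ⟨3 / 2, fun t _ x => hf.box _ _ (le_max_right _ _)⟩, fun x => ?_,
    fun x t ht => ?_⟩, hmean⟩
  · rw [hv, hv₀, max_self, hf.initial]
  · rw [hmean t ht, max_eq_left ht]
    refine (hf.deriv (κ x) t ht).congr_of_mem (fun s hs => ?_) ht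
    simp only [max_eq_left hs.out]

end CellFlow

end Cells

/-! ### Equilibria, transition times and the limit set -/

section Limits

variable {Ω : Type*} [MeasurableSpace Ω] {ν : Measure Ω} {η : ℝ} {μ α : ℕ → ℝ}
  {P : Cell → Set Ω} {κ : Ω → Cell} {F : ℝ → ℝ} {y : Cell → ℝ → ℝ} {a : ℕ → ℝ}

/-- The values of the equilibria on the cells. -/
def cellLimit (s : ℝ) : Cell → ℝ
  | .l => -1 + s
  | .m => -s
  | .r => 1 + s
  | .idx j => (-1) ^ j + s

theorem IsLabel.equilibrium_eq (hκ : IsLabel ν μ P κ) (s : ℝ) (x : Ω) :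
    equilibrium (leftSet P) (P .m) (rightSet P) s x = cellLimit s (κ x) := by
  have hL : x ∈ leftSet P ↔ κ x = .l ∨ ∃ k, κ x = .idx (2 * k + 1) := by
    simp [leftSet, hκ.mem_iff]
  have hM : x ∈ P .m ↔ κ x = .m := hκ.mem_iff _ _
  have hR : x ∈ rightSet P ↔ κ x = .r ∨ ∃ k, κ x = .idx (2 * k) := by
    simp [rightSet, hκ.mem_iff]
  generalize κ x = c at hL hM hR ⊢
  rcases c with _ | _ | _ | j
  · simp at hL hM hR
    simp [equilibrium, cellLimit, hL, hM, hR]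
  · simp at hL hM hR
    simp [equilibrium, cellLimit, hL, hM, hR]
  · simp at hL hM hR
    simp [equilibrium, cellLimit, hL, hM, hR]
  · simp only [reduceCtorEq, false_or, iff_false, Cell.idx.injEq] at hL hM hR
    rcases Nat.even_or_odd' j with ⟨k, rfl | rfl⟩
    · have hL' : x ∉ leftSet P := fun hx => by
        obtain ⟨k', h⟩ := hL.1 hx
        omega
      simp [equilibrium, cellLimit, hL', hM, hR.2 ⟨k, rfl⟩]
    · have hR' : x ∉ rightSet P := fun hx => by
        obtain ⟨k', h⟩ := hR.1 hx
        omega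
      simp [equilibrium, cellLimit, hR', hM, hL.2 ⟨k, rfl⟩, pow_succ]

/-- Bounded pointwise convergence implies convergence in `L²`. -/
theorem tendsto_eLpNorm_two_of_bounded [IsFiniteMeasure ν] {f : ℕ → Ω → ℝ} {C : ℝ}
    (hmeas : ∀ n, Measurable (f n)) (hbound : ∀ᶠ n in atTop, ∀ x, |f n x| ≤ C)
    (hlim : ∀ x, Tendsto (fun n => f n x) atTop (𝓝 0)) :
    Tendsto (fun n => eLpNorm (f n) 2 ν) atTop (𝓝 0) := by
  have h1 : Tendsto (fun n => ∫⁻ x, ‖f n x‖ₑ ^ (2 : ℝ) ∂ν) atTop (𝓝 (∫⁻ _, 0 ∂ν)) := by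
    refine tendsto_lintegral_filter_of_dominated_convergence
      (fun _ => ENNReal.ofReal C ^ (2 : ℝ))
      (Eventually.of_forall fun n => (hmeas n).enorm.pow_const _) ?_ ?_ ?_
    · filter_upwards [hbound] with n hn
      refine Eventually.of_forall fun x => ENNReal.rpow_le_rpow ?_ (by norm_num)
      rw [← ofReal_norm]
      exact ENNReal.ofReal_le_ofReal (hn x)
    · rw [lintegral_const]
      exact ENNReal.mul_ne_top (by finiteness) (by finiteness)
    · refine Eventually.of_forall fun x => ?_
      have h2 := ((hlim x).enorm).ennrpow_const (2 : ℝ)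
      simpa using h2
  rw [lintegral_zero] at h1
  have h3 := h1.ennrpow_const (1 / 2 : ℝ)
  rw [ENNReal.zero_rpow_of_pos (by norm_num)] at h3
  refine h3.congr fun n => ?_
  rw [eLpNorm_eq_lintegral_rpow_enorm_toReal (by norm_num) (by norm_num)]
  simp

namespace CellFlow

/-- Along times at which `q` converges, all cells converge to an equilibrium. -/
theorem tendsto_cellLimit (hp : Params η μ α) (hf : CellFlow μ α F y)
    (h : StageTimes η (y .m) (fun j => y (.idx j)) a) {s : ℝ} {t : ℕ → ℝ}
    (ht : Tendsto t atTop atTop) (hq : Tendsto (fun n => y .m (t n)) atTop (𝓝 (-s))) (c : Cell) :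
    Tendsto (fun n => y c (t n)) atTop (𝓝 (cellLimit s c)) := by
  have hr := hf.reducedFlow hp
  have key : ∀ (c : Cell) (T : ℝ) (n : ℕ), 0 ≤ T → 1 / 2 ≤ (-1) ^ n * y c T →
      Tendsto (fun n => y c (t n)) atTop (𝓝 ((-1) ^ n + s)) := by
    intro c T n hT hout
    have h1 := ((h.tendsto_outer hp hr hT n (hf.deriv c) hout).comp ht).add
      (hq.const_sub ((-1) ^ n))
    rw [zero_add, sub_neg_eq_add] at h1
    refine h1.congr fun m => ?_
    simp
  cases c with
  | l => simpa [cellLimit] using key .l 0 1 le_rfl (hf.left_zero hp)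
  | m => exact hq
  | r => simpa [cellLimit] using key .r 0 0 le_rfl (hf.right_zero hp)
  | idx j => exact key (.idx j) (a (j + 1)) j (h.nonneg _) (h.exit_eq j).ge

theorem tendsto_equilibrium (hp : Params η μ α) (hκ : IsLabel ν μ P κ) (hf : CellFlow μ α F y)
    (h : StageTimes η (y .m) (fun j => y (.idx j)) a) {s : ℝ} {t : ℕ → ℝ}
    (ht : Tendsto t atTop atTop) (hq : Tendsto (fun n => y .m (t n)) atTop (𝓝 (-s))) (x : Ω) :
    Tendsto (fun n => y (κ x) (max (t n) 0)) atTop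
      (𝓝 (equilibrium (leftSet P) (P .m) (rightSet P) s x)) := by
  rw [hκ.equilibrium_eq]
  refine (hf.tendsto_cellLimit hp h ht hq (κ x)).congr' ?_
  filter_upwards [ht.eventually (eventually_ge_atTop 0)] with n hn
  rw [max_eq_left hn]

theorem measurable_flow (hκ : IsLabel ν μ P κ) (y : Cell → ℝ → ℝ) (t : ℝ) :
    Measurable fun x => y (κ x) (max t 0) :=
  (measurable_of_countable fun c => y c (max t 0)).comp hκ.measurable

theorem isTransitionTime (hp : Params η μ α) (hκ : IsLabel ν μ P κ)
    (hf : CellFlow μ α F y) (h : StageTimes η (y .m) (fun j => y (.idx j)) a) (j : ℕ) {x : Ω}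
    (hx : x ∈ P (.idx j)) :
    IsTransitionTime (fun t x => y (κ x) (max t 0)) x (ENNReal.ofReal (a (j + 1))) := by
  have hr := hf.reducedFlow hp
  have hpos : 0 < a (j + 1) := (h.nonneg j).trans_lt (h.lt_succ j)
  rw [hκ.mem_iff] at hx
  refine ⟨ENNReal.ofReal_pos.2 hpos, fun t ht => ⟨fun hlt => ?_, fun hle => ?_⟩⟩
  · have h1 := h.middle_of_lt ht ((ENNReal.ofReal_lt_ofReal_iff hpos).1 hlt)
    simp only [hx, max_eq_left ht]
    exact abs_lt.1 h1
  · have h1 := h.outer_of_ge hr (Nat.lt_succ_self j) ((ENNReal.ofReal_le_ofReal_iff ht).1 hle)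
    have h2 := abs_le.1 (hf.box (.idx j) t ht)
    simp only [hx, max_eq_left ht]
    rcases neg_one_pow_eq_or ℝ j with hj | hj
    · rw [hj, one_mul] at h1
      exact Or.inr ⟨h1, h2.2⟩
    · rw [hj] at h1
      exact Or.inl ⟨h2.1, by linarith⟩

theorem isTransitionTime_top (hp : Params η μ α) (hκ : IsLabel ν μ P κ)
    (hf : CellFlow μ α F y) (h : StageTimes η (y .m) (fun j => y (.idx j)) a) {x : Ω}
    (hx : x ∈ P .m) : IsTransitionTime (fun t x => y (κ x) (max t 0)) x ⊤ := by
  have hr := hf.reducedFlow hp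
  rw [hκ.mem_iff] at hx
  refine ⟨ENNReal.zero_lt_top, fun t ht => ⟨fun _ => ?_, fun hle => ?_⟩⟩
  · simp only [hx, max_eq_left ht]
    exact abs_lt.1 ((h.abs_q_le hp hr ht).trans_lt hp.amplitude_lt)
  · simp at hle

variable [IsProbabilityMeasure ν]

theorem tendstoInMeasure_equilibrium (hp : Params η μ α) (hκ : IsLabel ν μ P κ)
    (hf : CellFlow μ α F y) (h : StageTimes η (y .m) (fun j => y (.idx j)) a) {s : ℝ} {t : ℕ → ℝ}
    (ht : Tendsto t atTop atTop) (hq : Tendsto (fun n => y .m (t n)) atTop (𝓝 (-s))) :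
    TendstoInMeasure ν (fun n x => y (κ x) (max (t n) 0)) atTop
      (equilibrium (leftSet P) (P .m) (rightSet P) s) :=
  tendstoInMeasure_of_tendsto_ae
    (fun _ => (measurable_flow hκ y _).aestronglyMeasurable)
    (Eventually.of_forall (hf.tendsto_equilibrium hp hκ h ht hq))

theorem tendsto_L2_equilibrium (hp : Params η μ α) (hκ : IsLabel ν μ P κ)
    (hf : CellFlow μ α F y) (h : StageTimes η (y .m) (fun j => y (.idx j)) a) {s : ℝ} {t : ℕ → ℝ}
    (ht : Tendsto t atTop atTop) (hq : Tendsto (fun n => y .m (t n)) atTop (𝓝 (-s))) :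
    Tendsto (fun n => eLpNorm (fun x => y (κ x) (max (t n) 0) -
      equilibrium (leftSet P) (P .m) (rightSet P) s x) 2 ν) atTop (𝓝 0) := by
  have hmeas : Measurable (equilibrium (leftSet P) (P .m) (rightSet P) s) := by
    have : equilibrium (leftSet P) (P .m) (rightSet P) s = cellLimit s ∘ κ :=
      funext (hκ.equilibrium_eq s)
    rw [this]
    exact (measurable_of_countable _).comp hκ.measurable
  refine tendsto_eLpNorm_two_of_bounded (C := 3 / 2 + (1 + |s|))
    (fun n => (measurable_flow hκ y (t n)).sub hmeas) (Eventually.of_forall fun n x => ?_)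
    fun x => ?_
  · have h1 := hf.box (κ x) (max (t n) 0) (le_max_right _ _)
    have h2 : |cellLimit s (κ x)| ≤ 1 + |s| := by
      have h4 := abs_neg s
      cases κ x with
      | l => simpa [cellLimit] using abs_add_le (-1) s
      | m => simp only [cellLimit]; linarith
      | r => simpa [cellLimit] using abs_add_le 1 s
      | idx j =>
        have h5 := abs_neg_one_pow_mul j 1
        rw [mul_one, abs_one] at h5
        have h6 := abs_add_le ((-1 : ℝ) ^ j) s
        rwa [h5] at h6
    have h3 := abs_sub (y (κ x) (max (t n) 0)) (cellLimit s (κ x))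
    rw [hκ.equilibrium_eq]
    linarith
  · simpa using (hf.tendsto_equilibrium hp hκ h ht hq x).sub_const
      (equilibrium (leftSet P) (P .m) (rightSet P) s x)

theorem omegaLimit_eq (hp : Params η μ α) (hκ : IsLabel ν μ P κ)
    (hf : CellFlow μ α F y) (h : StageTimes η (y .m) (fun j => y (.idx j)) a)
    (hβ : FastDecay μ α) :
    omegaLimitL2 ν (fun t x => y (κ x) (max t 0)) =
      {g : Lp ℝ 2 ν | ∃ s : ℝ, |s| ≤ amplitude η ∧
        g =ᵐ[ν] equilibrium (leftSet P) (P .m) (rightSet P) s} := by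
  have hr := hf.reducedFlow hp
  ext g
  constructor
  · rintro ⟨t, ht, hg⟩
    have hmeas : TendstoInMeasure ν (fun n x => y (κ x) (max (t n) 0)) atTop g :=
      tendstoInMeasure_of_tendsto_eLpNorm (p := 2) (by norm_num)
        (fun n => (measurable_flow hκ y (t n)).aestronglyMeasurable)
        (Lp.aestronglyMeasurable g) hg
    -- By compactness a subsequence of `q (t n)` converges; the state then tends to an equilibrium
    -- in measure, which identifies the limit `g`.
    have hfreq : ∃ᶠ n in atTop, y .m (t n) ∈ Icc (-amplitude η) (amplitude η) := by
      refine Eventually.frequently ?_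
      filter_upwards [ht.eventually (eventually_ge_atTop 0)] with n hn
      exact abs_le.1 (h.abs_q_le hp hr hn)
    obtain ⟨r, hrmem, φ, hφ, hlim⟩ := isCompact_Icc.tendsto_subseq' hfreq
    refine ⟨-r, by rw [abs_neg]; exact abs_le.2 hrmem, ?_⟩
    exact tendstoInMeasure_ae_unique (hmeas.comp hφ.tendsto_atTop)
      (hf.tendstoInMeasure_equilibrium hp hκ h (ht.comp hφ.tendsto_atTop)
        (by rw [neg_neg]; exact hlim))
  · rintro ⟨s, hs, hg⟩
    obtain ⟨t, ht, hq⟩ := h.exists_tendsto_q hp hr hβ (s := -s) (by rwa [abs_neg])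
    refine ⟨t, ht, (hf.tendsto_L2_equilibrium hp hκ h ht hq).congr fun n => ?_⟩
    refine eLpNorm_congr_ae ?_
    filter_upwards [hg] with x hx
    rw [hx]

theorem not_convergesInLp (hp : Params η μ α) (hκ : IsLabel ν μ P κ)
    (hf : CellFlow μ α F y) (h : StageTimes η (y .m) (fun j => y (.idx j)) a)
    (hβ : FastDecay μ α) (p : ℝ≥0∞) :
    ¬ ConvergesInLp ν p (fun t x => y (κ x) (max t 0)) := by
  have hr := hf.reducedFlow hp
  have hA := hp.amplitude_pos
  rintro ⟨g, hgm, hg⟩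
  have hmeas : TendstoInMeasure ν (fun t x => y (κ x) (max t 0)) atTop g := by
    rcases hg with ⟨-, hg⟩ | ⟨hp0, -, hg⟩
    · exact hg
    · exact tendstoInMeasure_of_tendsto_eLpNorm hp0
        (fun t => (measurable_flow hκ y t).aestronglyMeasurable) hgm hg
  have key : ∀ s, |s| ≤ amplitude η →
      g =ᵐ[ν] equilibrium (leftSet P) (P .m) (rightSet P) s := by
    intro s hs
    obtain ⟨t, ht, hq⟩ := h.exists_tendsto_q hp hr hβ (s := -s) (by rwa [abs_neg])
    exact tendstoInMeasure_ae_unique (hmeas.comp ht)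
      (hf.tendstoInMeasure_equilibrium hp hκ h ht hq)
  -- A limit would equal the equilibria for `s = 0` and `s = amplitude η` almost everywhere, but
  -- they differ on the middle cell, which has mass `1/2`.
  have hne : ν (P .m) ≠ 0 := by
    intro h0
    have h1 := hκ.mass .m
    rw [measureReal_def, h0] at h1
    norm_num [cellMass] at h1
  obtain ⟨x, hxm, hx⟩ := ((frequently_ae_mem_iff.2 hne).and_eventually
    ((key 0 (by simpa using hA.le)).and (key (amplitude η) (abs_of_pos hA).le))).exists
  rw [hκ.equilibrium_eq] at hx
  have h2 := hx.1.symm.trans hx.2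
  rw [hκ.equilibrium_eq, (hκ.mem_iff _ _).1 hxm, cellLimit, cellLimit] at h2
  linarith

end CellFlow

end Limits

end NonlocalODE

/-! ### Assembly -/

theorem mainTheorem2 {Ω : Type*} [MeasurableSpace Ω] (ν : Measure Ω) [IsProbabilityMeasure ν]
    (η : ℝ) (hη0 : 0 < η) (hη1 : η < 1)
    (μ α : ℕ → ℝ)
    (hμ0 : 0 < μ 0) (hμ0' : μ 0 ≤ (1 - η) / 4) (hμ : ∀ j, μ j = μ 0 * η ^ j)
    (hα0 : 0 < α 0) (hα0' : α 0 < 1 / 4)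
    (hα : ∀ j, 0 < α (j + 1) ∧ α (j + 1) ≤ α j * μ j)
    (P : Cell → Set Ω) (hPmeas : ∀ c, MeasurableSet (P c))
    (hPdisj : Pairwise (Function.onFun Disjoint P)) (hPcover : ⋃ c, P c = univ)
    (hPmass : ∀ c, ν.real (P c) = cellMass μ c)
    (v₀ : Ω → ℝ) (hv₀ : ∀ c, ∀ x ∈ P c, v₀ x = cellValue α c) :
    ∃ u : ℝ → Ω → ℝ,
      IsSolution ν fPL (fun x => v₀ x - ∫ y, v₀ y ∂ν) u ∧
      (∀ w : ℝ → Ω → ℝ, IsSolution ν fPL (fun x => v₀ x - ∫ y, v₀ y ∂ν) w →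
        ∀ t : ℝ, 0 ≤ t → w t = u t) ∧
      (∀ t : ℝ, 0 ≤ t → ∀ x, u t x ∈ Icc (-(3 / 2) : ℝ) (3 / 2)) ∧
      ((∀ x ∈ P .m, IsTransitionTime u x ⊤) ∧
        ∃ τ : ℕ → ℝ≥0∞, (∀ j, ∀ x ∈ P (.idx j), IsTransitionTime u x (τ j)) ∧
          ∀ j, τ j < τ (j + 1)) ∧
      ((∃ β : ℕ → ℝ, (∀ j, 0 < β j) ∧ Antitone β ∧ Tendsto β atTop (𝓝 0) ∧
          ∀ᶠ j in atTop, α (j + 1) ≤ α j * μ j * β j ^ (1 / μ j)) →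
        limsup (meanForce ν fPL u) atTop - liminf (meanForce ν fPL u) atTop
          = (1 - η) / (1 + η) ∧
        (∀ p : ℝ≥0∞, ¬ ConvergesInLp ν p u) ∧
        omegaLimitL2 ν u =
          {g : Lp ℝ 2 ν | ∃ s : ℝ, |s| ≤ 1 / 2 * ((1 - η) / (1 + η)) ∧
            g =ᵐ[ν] equilibrium (leftSet P) (P .m) (rightSet P) s}) := by
  have hp : Params η μ α := ⟨hη0, hη1, hμ0, hμ0', hμ, hα0, hα0', hα⟩
  obtain ⟨κ, hκ⟩ := exists_isLabel hPmeas hPdisj hPcover hPmass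
  obtain ⟨F, y, hf⟩ := exists_cellFlow hp hκ
  have hr := hf.reducedFlow hp
  obtain ⟨a, ha⟩ := exists_stageTimes hp hr
  obtain ⟨hsol, hmean⟩ := hf.isSolution hp hκ
    fun x => hv₀ (κ x) x ((hκ.mem_iff _ _).2 rfl)
  -- Freezing the state at negative times keeps the box bound valid for every real `t`. The
  -- transition time of `Ω_j` is `a (j + 1)`, the end of stage `j`.
  refine ⟨fun t x => y (κ x) (max t 0), hsol, fun w hw t ht => hsol.eq hw ht,
    fun t _ x => abs_le.1 (hf.box _ _ (le_max_right _ _)),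
    ⟨fun x hx => hf.isTransitionTime_top hp hκ ha hx, fun j => ENNReal.ofReal (a (j + 1)),
      fun j x hx => hf.isTransitionTime hp hκ ha j hx, fun j =>
        (ENNReal.ofReal_lt_ofReal_iff ((ha.nonneg _).trans_lt (ha.lt_succ _))).2
          (ha.lt_succ _)⟩,
    fun hβ => ⟨?_, hf.not_convergesInLp hp hκ ha hβ, hf.omegaLimit_eq hp hκ ha hβ⟩⟩
  have heq : meanForce ν fPL (fun t x => y (κ x) (max t 0)) =ᶠ[atTop] F := by
    filter_upwards [eventually_ge_atTop 0] with t ht using hmean t ht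
  rw [limsup_congr heq, liminf_congr heq]
  exact ha.limsup_sub_liminf hp hr hβ
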